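/- Let $(\Omega,\mathscr F,P)$ be a probability space, let $\mathbb X,\mathbb Y$ be Polish spaces with their Borel $\sigma$-fields, and let $\mu=(\mu_\omega)$ and $\nu=(\nu_\omega)$ be probability kernels from $\Omega$ to $\mathbb X$ and to $\mathbb Y$. Let $c:\Omega\times\mathbb X\times\mathbb Y\to[0,\infty)$ be such that $(x,y)\mapsto c(\omega,x,y)$ is continuous for each $\omega$, $\omega\mapsto c(\omega,x,y)$ is $\mathscr F$-measurable for each $(x,y)$, and $$\mathbb E\int_{\mathbb X\times\mathbb Y}c(\omega,x,y)\,\mu_\omega(dx)\,\nu_\omega(dy)<\infty .$$ Let $\mathcal K(\mu,\nu)$ be the set of probability kernels $\pi=(\pi_\omega)$ from $\Omega$ to $\mathbb X\times\mathbb Y$ such that, for every $\omega$, $\pi_\omega$ has marginals $\mu_\omega$ and $\nu_\omega$. Call $\pi\in\mathcal K(\mu,\nu)$ a *stochastic optimal transference plan* if it minimizes $\mathbb E\int_{\mathbb X\times\mathbb Y} c(\omega,x,y)\,\pi_\omega(dx,dy)$ over $\mathcal K(\mu,\nu)$. For $\omega\in\Omega$ put $c(\omega):=c(\omega,\cdot,\cdot)$.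 A set $G\subset\mathbb X\times\mathbb Y$ is *$c(\omega)$-cyclically monotone* if $\sum_{i=1}^N c(\omega,x_i,y_i)\le\sum_{i=1}^N c(\omega,x_i,y_{i+1})$, with $y_{N+1}:=y_1$, for all $N\ge1$ and $(x_1,y_1),\dots,(x_N,y_N)\in G$. A function $g:\mathbb X\to(-\infty,+\infty]$ is *$c(\omega)$-convex* if it is not identically $+\infty$ and there is $\zeta:\mathbb Y\to[-\infty,+\infty]$ with $g(x)=\sup_{y\in\mathbb Y}(\zeta(y)-c(\omega,x,y))$ for all $x$; its *$c(\omega)$-subdifferential* is $$\partial_c g:=\Big\{(x,y):\ \inf_{x'\in\mathbb X}\big(g(x')+c(\omega,x',y)\big)-g(x)=c(\omega,x,y)\Big\}.$$ **Theorem.** For any $\pi\in\mathcal K(\mu,\nu)$, the following statements are equivalent: (a) $\pi$ is a stochastic optimal transference plan; (b) for $P$-almost every $\omega$, the support of $\pi_\omega$ is $c(\omega)$-cyclically monotone; (c) there exist measurable functions $\phi:\Omega\times\mathbb Y\to[-\infty,+\infty)$ and $\psi:\Omega\times\mathbb X\to(-\infty,+\infty]$ such that $$\phi(\omega,y)-\psi(\omega,x)\le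 c(\omega,x,y)\qquad\text{for all }(\omega,x,y)\in\Omega\times\mathbb X\times\mathbb Y,$$ such that for every $\omega\in\Omega$ the function $\psi(\omega):=\psi(\omega,\cdot)$ is $c(\omega)$-convex and $$\Gamma_\omega:=\{(x,y):\ \phi(\omega,y)-\psi(\omega,x)=c(\omega,x,y)\}\subset\partial_c\psi(\omega),$$ and such that $\pi_\omega(\Gamma_\omega)=1$ for $P$-almost every $\omega$. Moreover, for every pair $(\phi,\psi)$ as in (c), the set $\Gamma:=\{(\omega,x,y):(x,y)\in\Gamma_\omega\}$ is measurable, and every stochastic optimal transference plan $\tilde\pi\in\mathcal K(\mu,\nu)$ satisfies $\tilde\pi_\omega(\Gamma_\omega)=1$ for $P$-almost every $\omega$. -/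

import Mathlib

open MeasureTheory ProbabilityTheory

/-! ### Deterministic notions for a real-valued cost `c : X → Y → ℝ` -/

/-- `Γ` is `c`-cyclically monotone: for all `N ≥ 1` and `(x₁, y₁), …, (x_N, y_N) ∈ Γ`,
`∑ c (x_i, y_i) ≤ ∑ c (x_i, y_{i+1})` with `y_{N+1} = y₁`.
The family is indexed by `Fin (n + 1)`, `N = n + 1`, where `i + 1` is cyclic. -/
def CyclicallyMonotone {X Y : Type*} (c : X → Y → ℝ) (Γ : Set (X × Y)) : Prop :=
  ∀ (n : ℕ) (p : Fin (n + 1) → X × Y), (∀ i, p i ∈ Γ) →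
    ∑ i, c (p i).1 (p i).2 ≤ ∑ i, c (p i).1 (p (i + 1)).2

/-- `ψ : X → (-∞, +∞]` is `c`-convex: it is not identically `+∞` and
`ψ x = sup_y (ζ y - c (x, y))` for some `ζ : Y → [-∞, +∞]`. -/
def CConvex {X Y : Type*} (c : X → Y → ℝ) (ψ : X → EReal) : Prop :=
  (∀ x, ψ x ≠ ⊥) ∧ (∃ x, ψ x ≠ ⊤) ∧
    ∃ ζ : Y → EReal, ∀ x, ψ x = ⨆ y, (ζ y - (c x y : EReal))

/-- The `c`-transform `ψᶜ y = inf_x (ψ x + c (x, y))`. -/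
noncomputable def cTransform {X Y : Type*} (c : X → Y → ℝ) (ψ : X → EReal) (y : Y) : EReal :=
  ⨅ x, (ψ x + (c x y : EReal))

/-- The `c`-subdifferential `∂_c ψ = {(x, y) : ψᶜ y - ψ x = c (x, y)}`. -/
def cSubdifferential {X Y : Type*} (c : X → Y → ℝ) (ψ : X → EReal) : Set (X × Y) :=
  {p | cTransform c ψ p.2 - ψ p.1 = (c p.1 p.2 : EReal)}

/-! ### The stochastic transport problem -/

/-- `𝒦(μ, ν)`: the probability kernels from `Ω` to `X × Y` whose marginal kernels are
`μ` and `ν`. -/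
def TransportKernels {Ω X Y : Type*} [MeasurableSpace Ω] [MeasurableSpace X] [MeasurableSpace Y]
    (μ : Kernel Ω X) (ν : Kernel Ω Y) : Set (Kernel Ω (X × Y)) :=
  {π | IsMarkovKernel π ∧ π.fst = μ ∧ π.snd = ν}

/-- The expected cost `𝔼 ∫ c(ω, x, y) π_ω(dx, dy) ∈ [0, ∞]` (for a nonnegative cost `c`). -/
noncomputable def expectedCost {Ω X Y : Type*} [MeasurableSpace Ω] [MeasurableSpace X]
    [MeasurableSpace Y] (P : Measure Ω) (c : Ω → X → Y → ℝ) (π : Kernel Ω (X × Y)) : ENNReal :=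
  ∫⁻ ω, ∫⁻ p, ENNReal.ofReal (c ω p.1 p.2) ∂(π ω) ∂P

/-- The value of the stochastic Monge-Kantorovich problem. -/
noncomputable def stochasticCost {Ω X Y : Type*} [MeasurableSpace Ω] [MeasurableSpace X]
    [MeasurableSpace Y] (P : Measure Ω) (c : Ω → X → Y → ℝ) (μ : Kernel Ω X) (ν : Kernel Ω Y) :
    ENNReal :=
  ⨅ π ∈ TransportKernels μ ν, expectedCost P c π

/-- `π` is a stochastic optimal transference plan: it lies in `𝒦(μ, ν)` and attains the
infimum. -/
def IsStochasticOptimal {Ω X Y : Type*} [MeasurableSpace Ω] [MeasurableSpace X]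
    [MeasurableSpace Y] (P : Measure Ω) (c : Ω → X → Y → ℝ) (μ : Kernel Ω X) (ν : Kernel Ω Y)
    (π : Kernel Ω (X × Y)) : Prop :=
  π ∈ TransportKernels μ ν ∧ expectedCost P c π = stochasticCost P c μ ν

/-- The equality set `Γ_ω = {(x, y) : φ(ω, y) - ψ(ω, x) = c(ω, x, y)}`. Since `c` is real, the
equality forces `φ(ω, y)` and `ψ(ω, x)` to be finite. -/
def contactSet {Ω X Y : Type*} (c : Ω → X → Y → ℝ) (φ : Ω × Y → EReal) (ψ : Ω × X → EReal)
    (ω : Ω) : Set (X × Y) :=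
  {p | φ (ω, p.2) - ψ (ω, p.1) = (c ω p.1 p.2 : EReal)}

/-- `(φ, ψ)` is a pair of measurable potentials adapted to `π`: `φ - ψ ≤ c` everywhere, and
`ψ(ω, ·)` is `c(ω)`-convex with `Γ_ω ⊆ ∂_c ψ(ω)` for every `ω`, and `Γ_ω` has full `π_ω`-measure
for almost every `ω`.
`ψ` has values in `(-∞, +∞]` (by `c`-convexity). As `ψ(ω, ·)` is not identically `+∞`, the
inequality forces `φ < +∞`; so the difference `φ - ψ` is never of the form `∞ - ∞`. -/
structure IsPotentialPair {Ω X Y : Type*} [MeasurableSpace Ω] [MeasurableSpace X]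
    [MeasurableSpace Y] (P : Measure Ω) (c : Ω → X → Y → ℝ) (π : Kernel Ω (X × Y))
    (φ : Ω × Y → EReal) (ψ : Ω × X → EReal) : Prop where
  measurable_left : Measurable φ
  measurable_right : Measurable ψ
  sub_le : ∀ ω x y, φ (ω, y) - ψ (ω, x) ≤ (c ω x y : EReal)
  cConvex : ∀ ω, CConvex (c ω) (fun x => ψ (ω, x))
  contactSet_subset : ∀ ω, contactSet c φ ψ ω ⊆ cSubdifferential (c ω) (fun x => ψ (ω, x))
  full_measure : ∀ᵐ ω ∂P, ∀ᵐ p ∂(π ω), p ∈ contactSet c φ ψ ω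

/-! Optimality implies monotonicity by a local exchange. A violated cycle in the support of `π ω`
persists, by continuity of the cost, on small rectangles of positive mass. Moving a little mass
cyclically between them keeps the marginals and lowers the cost. Basic open sets, rational cost
bounds and masses `1 / (k + 1)` give only countably many configurations, so each one can be treated
on its own measurable set of `ω`, with one and the same swap; `IsStochasticOptimal.measure_eq_zero`
makes that set null.

Monotonicity yields potentials through Rüschendorf's chain construction. To keep `ψ` measurable in
`ω`, chains run only through a measurable sequence dense in the support
(`exists_measurable_dense_support`), and continuity carries the key inequality to the whole support.
The transform of `ψ` is an infimum over an uncountable space, so its measurability is unclear. But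
on the support it equals `ψ + c`, and so it can be recovered as a conditional mean given `y`; `φ` is
this mean where it is meaningful and `⊥` elsewhere.

Potentials imply optimality by duality for each `ω` (`optimal_of_ae_contact`). They need not be
integrable, so they are truncated: the truncated difference stays below `c`, has the same integral
under all plans with the given marginals, and converges to `c` on the contact set. Fatou's lemma
then also forces every optimal plan of finite cost onto that set. -/

/-! ### Rüschendorf potentials along a sequence -/

section ChainPotential

variable {X Y : Type*}

/-- Rüschendorf's chain sums: for a sequence `z` of points of `X × Y` and a list of indices
`[n₁, …, n_k]`, the sum along the chain `x ← z n₁ ← … ← z n_k ← z 0`. -/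
def chainSum (c : X → Y → ℝ) (z : ℕ → X × Y) : List ℕ → X → ℝ
  | [], x => c (z 0).1 (z 0).2 - c x (z 0).2
  | n :: l, x => chainSum c z l (z n).1 + c (z n).1 (z n).2 - c x (z n).2

/-- The supremum of all chain sums. -/
noncomputable def chainPotential (c : X → Y → ℝ) (z : ℕ → X × Y) (x : X) : EReal :=
  ⨆ l : List ℕ, (chainSum c z l x : EReal)

lemma exists_chainSum_eq (c : X → Y → ℝ) (z : ℕ → X × Y) (l : List ℕ) :
    ∃ (a : ℝ) (y : Y), ∀ x, chainSum c z l x = a - c x y := by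
  cases l with
  | nil => exact ⟨_, _, fun x => rfl⟩
  | cons n l => exact ⟨_, _, fun x => rfl⟩

lemma cConvex_iSup {ι : Type*} [Nonempty ι] (c : X → Y → ℝ) (a : ι → ℝ) (y : ι → Y)
    (h : ∃ x, (⨆ i, ((a i - c x (y i) : ℝ) : EReal)) ≠ ⊤) :
    CConvex c fun x => ⨆ i, ((a i - c x (y i) : ℝ) : EReal) := by
  -- Several indices may share one `y`; `ζ` takes the best constant among them, and `⊥` where there
  -- is none.
  refine ⟨fun x => ?_, h, fun y' => ⨆ (i : ι) (_ : y i = y'), (a i : EReal), fun x => ?_⟩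
  · obtain ⟨i⟩ := ‹Nonempty ι›
    exact (lt_of_lt_of_le (EReal.bot_lt_coe _)
      (le_iSup (fun i => ((a i - c x (y i) : ℝ) : EReal)) i)).ne'
  · apply le_antisymm
    · refine iSup_le fun i => le_trans ?_
        (le_iSup (fun y' => (⨆ (i : ι) (_ : y i = y'), (a i : EReal)) - (c x y' : EReal)) (y i))
      rw [EReal.coe_sub]
      exact EReal.sub_le_sub (le_iSup₂ (f := fun j (_ : y j = y i) => (a j : EReal)) i rfl) le_rfl
    · refine iSup_le fun y' => EReal.sub_le_of_le_add (iSup₂_le fun i hi => ?_)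
      subst hi
      have := le_iSup (fun i => ((a i - c x (y i) : ℝ) : EReal)) i
      refine le_trans ?_ (add_le_add_left this _)
      rw [← EReal.coe_add]
      simp

/-- Unrolls the recursion into the indexing of cyclic monotonicity; the final index is always `0`,
the base point. -/
lemma exists_fin_chain (c : X → Y → ℝ) (z : ℕ → X × Y) (l : List ℕ) :
    ∃ (k : ℕ) (p : Fin (k + 1) → ℕ), p (Fin.last k) = 0 ∧ ∀ x, chainSum c z l x =
      (∑ i, c (z (p i)).1 (z (p i)).2) - c x (z (p 0)).2
        - ∑ i : Fin k, c (z (p i.castSucc)).1 (z (p i.succ)).2 := by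
  induction l with
  | nil => exact ⟨0, fun _ => 0, rfl, fun x => by simp [chainSum]⟩
  | cons n l ih =>
    obtain ⟨k, p, hp, h⟩ := ih
    refine ⟨k + 1, Fin.cons n p, by simp [← Fin.succ_last, hp], fun x => ?_⟩
    rw [chainSum, h, Fin.sum_univ_succ (n := k + 1),
      Fin.sum_univ_succ fun i : Fin (k + 1) =>
        c (z ((Fin.cons n p : Fin (k + 2) → ℕ) i.castSucc)).1
          (z ((Fin.cons n p : Fin (k + 2) → ℕ) i.succ)).2]
    simp only [Fin.cons_zero, Fin.cons_succ, Fin.castSucc_zero, ← Fin.succ_castSucc]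
    ring

/-- Evaluated at the base point, the chain closes up into a cycle. -/
lemma CyclicallyMonotone.chainSum_nonpos {c : X → Y → ℝ} {Γ : Set (X × Y)}
    (h : CyclicallyMonotone c Γ) {z : ℕ → X × Y} (hz : ∀ n, z n ∈ Γ) (l : List ℕ) :
    chainSum c z l (z 0).1 ≤ 0 := by
  obtain ⟨k, p, hp, hl⟩ := exists_fin_chain c z l
  have key := h k (fun i => z (p i)) fun i => hz _
  rw [Fin.sum_univ_castSucc (fun i => c (z (p i)).1 (z (p (i + 1))).2)] at key
  simp only [Fin.last_add_one, Fin.coeSucc_eq_succ, hp] at key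
  rw [hl]
  linarith

lemma CyclicallyMonotone.chainPotential_nonpos {c : X → Y → ℝ} {Γ : Set (X × Y)}
    (h : CyclicallyMonotone c Γ) {z : ℕ → X × Y} (hz : ∀ n, z n ∈ Γ) :
    chainPotential c z (z 0).1 ≤ 0 :=
  iSup_le fun l => by exact_mod_cast h.chainSum_nonpos hz l

lemma CyclicallyMonotone.cConvex_chainPotential {c : X → Y → ℝ} {Γ : Set (X × Y)}
    (h : CyclicallyMonotone c Γ) {z : ℕ → X × Y} (hz : ∀ n, z n ∈ Γ) :
    CConvex c (chainPotential c z) := by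
  choose a y hay using exists_chainSum_eq c z
  have : chainPotential c z = fun x => ⨆ l, ((a l - c x (y l) : ℝ) : EReal) := by
    funext x
    simp only [chainPotential, hay]
  have h0 := h.chainPotential_nonpos hz
  rw [this] at h0 ⊢
  exact cConvex_iSup c a y ⟨_, ne_top_of_le_ne_top EReal.zero_ne_top h0⟩

variable [TopologicalSpace X] [TopologicalSpace Y]

/-- At `p = z n` this is the effect of prepending `n` to every chain. For one fixed chain the
inequality is closed in `p`, so it passes to the closure before the supremum over chains is taken.
-/
lemma chainPotential_add_le {c : X → Y → ℝ} (hc : Continuous fun p : X × Y => c p.1 p.2)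
    {z : ℕ → X × Y} {p : X × Y} (hp : p ∈ closure (Set.range z)) (x : X) :
    chainPotential c z p.1 + (c p.1 p.2 : EReal) ≤ chainPotential c z x + (c x p.2 : EReal) := by
  have key (l : List ℕ) :
      ((chainSum c z l p.1 + c p.1 p.2 - c x p.2 : ℝ) : EReal) ≤ chainPotential c z x := by
    obtain ⟨a, y, hay⟩ := exists_chainSum_eq c z l
    have hcont : Continuous fun q : X × Y => chainSum c z l q.1 + c q.1 q.2 - c x q.2 := by
      simp only [hay]
      have h1 : Continuous fun q : X × Y => c q.1 y :=
        hc.comp (continuous_fst.prodMk continuous_const)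
      have h2 : Continuous fun q : X × Y => c x q.2 :=
        hc.comp (continuous_const.prodMk continuous_snd)
      fun_prop
    have hcl : IsClosed {q : X × Y | ((chainSum c z l q.1 + c q.1 q.2 - c x q.2 : ℝ) : EReal)
        ≤ chainPotential c z x} :=
      isClosed_le (continuous_coe_real_ereal.comp hcont) continuous_const
    refine closure_minimal ?_ hcl hp
    rintro _ ⟨n, rfl⟩
    exact le_iSup (fun l => (chainSum c z l x : EReal)) (n :: l)
  refine EReal.add_le_of_le_sub (iSup_le fun l => ?_)
  rw [EReal.le_sub_iff_add_le (.inl (EReal.coe_ne_bot _)) (.inl (EReal.coe_ne_top _)),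
    ← EReal.sub_le_iff_le_add (.inl (EReal.coe_ne_bot _)) (.inl (EReal.coe_ne_top _))]
  exact_mod_cast key l

lemma CyclicallyMonotone.chainPotential_ne_top {c : X → Y → ℝ}
    (hc : Continuous fun p : X × Y => c p.1 p.2) {Γ : Set (X × Y)} (h : CyclicallyMonotone c Γ)
    {z : ℕ → X × Y} (hz : ∀ n, z n ∈ Γ) {p : X × Y} (hp : p ∈ closure (Set.range z)) :
    chainPotential c z p.1 ≠ ⊤ := by
  intro htop
  have h1 := chainPotential_add_le hc hp (z 0).1
  have h2 := h.chainPotential_nonpos hz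
  rw [htop, EReal.top_add_coe] at h1
  have h3 := h1.trans (add_le_add_left h2 _)
  rw [zero_add] at h3
  exact EReal.coe_ne_top _ (top_le_iff.1 h3)

lemma cTransform_chainPotential {c : X → Y → ℝ}
    (hc : Continuous fun p : X × Y => c p.1 p.2) {z : ℕ → X × Y}
    {p : X × Y} (hp : p ∈ closure (Set.range z)) :
    cTransform c (chainPotential c z) p.2 = chainPotential c z p.1 + (c p.1 p.2 : EReal) :=
  le_antisymm (iInf_le (fun x => chainPotential c z x + (c x p.2 : EReal)) p.1)
    (le_iInf fun x => chainPotential_add_le hc hp x)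

end ChainPotential

/-! ### Measurable selections from the support of a kernel -/

section MeasurableSelection

open Filter Topology

lemma exists_measurable_restrict_ball {Z : Type*} [MetricSpace Z] [SecondCountableTopology Z]
    [Nonempty Z] [MeasurableSpace Z] [BorelSpace Z] {r : ℝ} (hr : 0 < r) :
    ∃ (x : Measure Z → Z) (F : Measure Z → Measure Z), Measurable x ∧ Measurable F ∧
      ∀ m, F m ≤ m ∧ (m ≠ 0 → F m ≠ 0) ∧ F m (Metric.ball (x m) r)ᶜ = 0 := by
  classical
  set d := TopologicalSpace.denseSeq Z
  -- The alternative `m = 0` makes the search for the least index total.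
  have hex (m : Measure Z) : ∃ n, m = 0 ∨ 0 < m (Metric.ball (d n) r) := by
    by_contra! h
    have hU : (⋃ n, Metric.ball (d n) r) = Set.univ :=
      Set.eq_univ_of_forall fun z => Set.mem_iUnion.2
        ((TopologicalSpace.denseRange_denseSeq Z).exists_dist_lt z hr)
    refine (h 0).1 (Measure.measure_univ_eq_zero.1 ?_)
    rw [← hU, measure_iUnion_null_iff]
    exact fun n => le_zero_iff.1 (h n).2
  have hn : Measurable fun m => Nat.find (hex m) := by
    refine measurable_find hex fun k => MeasurableSet.union ?_ ?_
    · have : {m : Measure Z | m = 0} = (fun m => m Set.univ) ⁻¹' {0} := by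
        ext m
        simp
      change MeasurableSet {m : Measure Z | m = 0}
      rw [this]
      exact Measure.measurable_coe MeasurableSet.univ (measurableSet_singleton 0)
    · exact Measure.measurable_coe Metric.isOpen_ball.measurableSet measurableSet_Ioi
  refine ⟨fun m => d (Nat.find (hex m)),
    fun m => m.restrict (Metric.ball (d (Nat.find (hex m))) r),
    (measurable_of_countable d).comp hn, ?_, fun m => ⟨Measure.restrict_le_self, fun hm => ?_, ?_⟩⟩
  · have : Measurable fun q : ℕ × Measure Z => q.2.restrict (Metric.ball (d q.1) r) := by
      refine measurable_from_prod_countable_right fun n => ?_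
      refine Measure.measurable_of_measurable_coe _ fun s hs => ?_
      simp only [Measure.restrict_apply hs]
      exact Measure.measurable_coe (hs.inter Metric.isOpen_ball.measurableSet)
    exact this.comp (hn.prodMk measurable_id)
  · rw [Ne, Measure.restrict_eq_zero]
    exact ((Nat.find_spec (hex m)).resolve_left hm).ne'
  · rw [Measure.restrict_apply Metric.isOpen_ball.measurableSet.compl]
    simp

/-- Repeatedly restricting to charged balls of radius `(1 / 2) ^ k` leaves nonzero measures below `κ
ω`; the measurably chosen centres converge, and the limit has charged neighbourhoods only. -/
lemma exists_measurable_mem_support {Ω Z : Type*} [MeasurableSpace Ω] [TopologicalSpace Z]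
    [PolishSpace Z] [MeasurableSpace Z] [BorelSpace Z] {κ : Ω → Measure Z} (hκ : Measurable κ)
    (h0 : ∀ ω, κ ω ≠ 0) : ∃ s : Ω → Z, Measurable s ∧ ∀ ω, s ω ∈ (κ ω).support := by
  rcases isEmpty_or_nonempty Ω with hΩ | ⟨⟨ω₀⟩⟩
  · exact ⟨fun ω => isEmptyElim ω, measurable_of_empty _, fun ω => isEmptyElim ω⟩
  let := TopologicalSpace.upgradeIsCompletelyMetrizable Z
  have : Nonempty Z := ⟨(Measure.nonempty_support (h0 ω₀)).some⟩
  choose x F hx hF hFx using fun k : ℕ =>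
    exists_measurable_restrict_ball (Z := Z) (r := (1 / 2 : ℝ) ^ k) (by positivity)
  let g : ℕ → Ω → Measure Z := fun k => Nat.rec κ (fun k gk ω => F k (gk ω)) k
  have hg (k : ℕ) : Measurable (g k) := by
    induction k with
    | zero => exact hκ
    | succ k ih => exact (hF k).comp ih
  have hg0 (k : ℕ) (ω : Ω) : g k ω ≠ 0 := by
    induction k with
    | zero => exact h0 ω
    | succ k ih => exact (hFx k _).2.1 ih
  have hgle (k : ℕ) (ω : Ω) : g k ω ≤ κ ω := by
    induction k with
    | zero => exact le_rfl
    | succ k ih => exact ((hFx k _).1).trans ih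
  have hball (k : ℕ) (ω : Ω) : g (k + 1) ω (Metric.ball (x k (g k ω)) ((1 / 2) ^ k))ᶜ = 0 :=
    (hFx k _).2.2
  -- Two consecutive balls both carry the nonzero measure `g (k + 2) ω`, hence they meet.
  have hdist (ω : Ω) (k : ℕ) :
      dist (x k (g k ω)) (x (k + 1) (g (k + 1) ω)) ≤ 2 * (1 / 2 : ℝ) ^ k := by
    have h1 : ∀ᵐ z ∂(g (k + 2) ω), z ∈ Metric.ball (x k (g k ω)) ((1 / 2) ^ k) :=
      Measure.absolutelyContinuous_of_le (hFx (k + 1) _).1 (hball k ω)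
    have h2 : ∀ᵐ z ∂(g (k + 2) ω), z ∈ Metric.ball (x (k + 1) (g (k + 1) ω)) ((1 / 2) ^ (k + 1)) :=
      hball (k + 1) ω
    have : (ae (g (k + 2) ω)).NeBot := ae_neBot.2 (hg0 (k + 2) ω)
    obtain ⟨z, hz1, hz2⟩ := (h1.and h2).exists
    rw [Metric.mem_ball'] at hz1
    rw [Metric.mem_ball] at hz2
    have h3 : (1 / 2 : ℝ) ^ (k + 1) ≤ (1 / 2) ^ k :=
      pow_le_pow_of_le_one (by norm_num) (by norm_num) (Nat.le_succ k)
    linarith [dist_triangle (x k (g k ω)) z (x (k + 1) (g (k + 1) ω))]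
  choose s hs using fun ω => cauchySeq_tendsto_of_complete
    (cauchySeq_of_le_geometric (1 / 2 : ℝ) 2 (by norm_num) (hdist ω))
  refine ⟨s, measurable_of_tendsto_metrizable (fun k => (hx k).comp (hg k))
    (tendsto_pi_nhds.2 hs), fun ω => (Measure.mem_support_iff_forall _).2 fun U hU => ?_⟩
  obtain ⟨ε, hε, hεU⟩ := Metric.mem_nhds_iff.1 hU
  have hr : Tendsto (fun k : ℕ => (1 / 2 : ℝ) ^ k) atTop (𝓝 0) :=
    tendsto_pow_atTop_nhds_zero_of_lt_one (by norm_num) (by norm_num)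
  obtain ⟨k, hk1, hk2⟩ := ((hr.eventually (gt_mem_nhds (half_pos hε))).and
    ((hs ω).eventually (Metric.ball_mem_nhds (s ω) (half_pos hε)))).exists
  have hsub : Metric.ball (x k (g k ω)) ((1 / 2) ^ k) ⊆ U := by
    refine (Metric.ball_subset_ball' ?_).trans hεU
    linarith
  refine pos_iff_ne_zero.2 fun hU0 => hg0 (k + 1) ω (Measure.measure_univ_eq_zero.1 ?_)
  have h1 : g (k + 1) ω U = 0 := le_zero_iff.1 ((hgle (k + 1) ω U).trans hU0.le)
  have h2 := measure_mono_null (Set.compl_subset_compl.2 hsub) (hball k ω)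
  rw [← Set.union_compl_self U]
  exact measure_union_null h1 h2

/-- A Castaing representation of the support of a kernel. -/
lemma exists_measurable_dense_support {Ω Z : Type*} [MeasurableSpace Ω] [TopologicalSpace Z]
    [PolishSpace Z] [MeasurableSpace Z] [BorelSpace Z] (κ : Kernel Ω Z) (h0 : ∀ ω, κ ω ≠ 0) :
    ∃ s : ℕ → Ω → Z, (∀ n, Measurable (s n)) ∧ (∀ n ω, s n ω ∈ (κ ω).support) ∧
      ∀ ω, (κ ω).support ⊆ closure (Set.range fun n => s n ω) := by
  classical
  obtain ⟨s₀, hs₀, hs₀'⟩ := exists_measurable_mem_support κ.measurable h0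
  have key (U : Set Z) (hU : IsOpen U) : ∃ s : Ω → Z, Measurable s ∧
      (∀ ω, s ω ∈ (κ ω).support) ∧ ∀ ω, 0 < κ ω U → s ω ∈ closure U := by
    have hA : MeasurableSet {ω | κ ω U = 0} :=
      κ.measurable_coe hU.measurableSet (measurableSet_singleton 0)
    -- Where `U` is null the restriction would vanish, so the original kernel is kept there.
    let η := Kernel.piecewise hA κ (κ.restrict hU.measurableSet)
    obtain ⟨s, hs, hs'⟩ := exists_measurable_mem_support η.measurable fun ω => by
      rw [Kernel.piecewise_apply]
      split_ifs with h
      · exact h0 ω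
      · rwa [Kernel.restrict_apply, Ne, Measure.restrict_eq_zero]
    refine ⟨s, hs, fun ω => ?_, fun ω hω => ?_⟩
    · have := hs' ω
      rw [Kernel.piecewise_apply] at this
      split_ifs at this with h
      · exact this
      · exact (Measure.support_restrict_subset this).2
    · have := hs' ω
      rw [Kernel.piecewise_apply, if_neg (show ω ∉ {ω | κ ω U = 0} from hω.ne')] at this
      exact (Measure.support_restrict_subset this).1
  have : Nonempty (Ω → Z) := ⟨s₀⟩
  choose! s hs hs1 hs2 using key
  obtain ⟨b, hbc, -, hb⟩ := TopologicalSpace.exists_countable_basis Z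
  rcases b.eq_empty_or_nonempty with rfl | hne
  · refine ⟨fun _ => s₀, fun _ => hs₀, fun _ => hs₀', fun ω z _ => ?_⟩
    obtain ⟨v, hv, -⟩ := hb.mem_nhds_iff.1 (Filter.univ_mem (f := 𝓝 z))
    exact absurd hv (Set.notMem_empty v)
  obtain ⟨f, rfl⟩ := hbc.exists_eq_range hne
  have hopen (n : ℕ) : IsOpen (f n) := hb.isOpen ⟨n, rfl⟩
  refine ⟨fun n => s (f n), fun n => hs _ (hopen n), fun n => hs1 _ (hopen n), fun ω z hz => ?_⟩
  rw [mem_closure_iff_nhds]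
  intro t ht
  -- The selections lie only in the closure of a basic set, so the neighbourhood is first shrunk to
  -- a closed one.
  obtain ⟨t', ht', hcl, htt⟩ := exists_mem_nhds_isClosed_subset ht
  obtain ⟨_, ⟨n, rfl⟩, hzn, hnt⟩ := hb.mem_nhds_iff.1 ht'
  have hpos : 0 < κ ω (f n) :=
    (Measure.mem_support_iff_forall z).1 hz _ ((hopen n).mem_nhds hzn)
  exact ⟨_, htt (closure_minimal hnt hcl (hs2 _ (hopen n) ω hpos)), n, rfl⟩

end MeasurableSelection

/-! ### Truncated potentials and duality for a fixed cost -/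

section Truncation

open Filter Topology

/-- The truncation of an extended real number to `[-n, n]`. -/
noncomputable def erealTrunc (n : ℕ) (a : EReal) : ℝ :=
  (max ((-n : ℝ) : EReal) (min a ((n : ℝ) : EReal))).toReal

lemma neg_natCast_le_natCast_ereal (n : ℕ) : ((-n : ℝ) : EReal) ≤ ((n : ℝ) : EReal) :=
  EReal.coe_le_coe_iff.2 (by linarith [n.cast_nonneg (α := ℝ)])

lemma coe_erealTrunc (n : ℕ) (a : EReal) :
    (erealTrunc n a : EReal) = max ((-n : ℝ) : EReal) (min a ((n : ℝ) : EReal)) :=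
  EReal.coe_toReal (ne_top_of_le_ne_top (EReal.coe_ne_top n)
      (max_le (neg_natCast_le_natCast_ereal n) (min_le_right _ _)))
    (ne_bot_of_le_ne_bot (EReal.coe_ne_bot (-n)) (le_max_left _ _))

lemma measurable_erealTrunc (n : ℕ) : Measurable (erealTrunc n) :=
  (measurable_const.max (measurable_id.min measurable_const)).ereal_toReal

lemma abs_erealTrunc_le (n : ℕ) (a : EReal) : |erealTrunc n a| ≤ n := by
  rw [abs_le, ← EReal.coe_le_coe_iff, ← EReal.coe_le_coe_iff, coe_erealTrunc]
  exact ⟨le_max_left _ _, max_le (neg_natCast_le_natCast_ereal n) (min_le_right _ _)⟩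

lemma erealTrunc_mono (n : ℕ) : Monotone (erealTrunc n) := fun a b h => by
  rw [← EReal.coe_le_coe_iff, coe_erealTrunc, coe_erealTrunc]
  gcongr

/-- Raising the argument by `c ≥ 0` raises the truncation by at most `c`. -/
lemma erealTrunc_sub_le (n : ℕ) {a b : EReal} (hb : b ≠ ⊥) {c : ℝ} (hc : 0 ≤ c)
    (h : a - b ≤ (c : EReal)) : erealTrunc n a - erealTrunc n b ≤ c := by
  rw [EReal.sub_le_iff_le_add (.inl hb) (.inr (EReal.coe_ne_bot c))] at h
  rw [sub_le_iff_le_add, ← EReal.coe_le_coe_iff, EReal.coe_add, coe_erealTrunc, coe_erealTrunc]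
  have hc' : (0 : EReal) ≤ c := EReal.coe_nonneg.2 hc
  refine max_le (le_add_of_nonneg_of_le hc' (le_max_left _ _)) ?_
  refine le_trans ?_ (add_le_add_right (le_max_right _ _) _)
  rcases le_total b ((n : ℝ) : EReal) with hbn | hbn
  · rw [min_eq_left hbn]
    exact (min_le_left _ _).trans h
  · rw [min_eq_right hbn]
    exact le_add_of_nonneg_of_le hc' (min_le_right _ _)

lemma tendsto_erealTrunc (a : EReal) :
    Tendsto (fun n => (erealTrunc n a : EReal)) atTop (𝓝 a) := by
  simp only [coe_erealTrunc]
  have h1 : Tendsto (fun n : ℕ => ((n : ℝ) : EReal)) atTop (𝓝 ⊤) :=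
    EReal.tendsto_coe_nhds_top_iff.2 tendsto_natCast_atTop_atTop
  have h2 : Tendsto (fun n : ℕ => ((-n : ℝ) : EReal)) atTop (𝓝 ⊥) :=
    EReal.tendsto_coe_nhds_bot_iff.2 (tendsto_neg_atTop_atBot.comp tendsto_natCast_atTop_atTop)
  simpa using h2.max ((tendsto_const_nhds (x := a)).min h1)

lemma tendsto_erealTrunc_sub {a b : EReal} (ha : a ≠ ⊤) (hb : b ≠ ⊥) :
    Tendsto (fun n => ((erealTrunc n a - erealTrunc n b : ℝ) : EReal)) atTop (𝓝 (a - b)) := by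
  simp only [EReal.coe_sub]
  simp only [sub_eq_add_neg]
  have hcont : ContinuousAt (fun p : EReal × EReal => p.1 + p.2) (a, -b) :=
    EReal.continuousAt_add (.inl ha) (.inr (by simpa using hb))
  exact hcont.tendsto.comp ((tendsto_erealTrunc a).prodMk_nhds
    ((continuous_neg.tendsto b).comp (tendsto_erealTrunc b)))

lemma sub_eq_coe_of_liminf_erealTrunc {a b : EReal} (ha : a ≠ ⊤) (hb : b ≠ ⊥) {c : ℝ}
    (h : a - b ≤ (c : EReal))
    (h0 : liminf (fun n => ENNReal.ofReal (c - (erealTrunc n a - erealTrunc n b))) atTop = 0) :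
    a - b = (c : EReal) := by
  refine h.antisymm (not_lt.1 fun hlt => ?_)
  obtain ⟨r, hr1, hr2⟩ := EReal.lt_iff_exists_real_btwn.1 hlt
  have hr2' : r < c := by exact_mod_cast hr2
  have hev : ∀ᶠ n in atTop, ENNReal.ofReal (c - r) ≤
      ENNReal.ofReal (c - (erealTrunc n a - erealTrunc n b)) := by
    filter_upwards [(tendsto_erealTrunc_sub ha hb).eventually (gt_mem_nhds hr1)] with n hn
    have : erealTrunc n a - erealTrunc n b < r := by exact_mod_cast hn
    exact ENNReal.ofReal_le_ofReal (by linarith)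
  have := le_liminf_of_le (by isBoundedDefault) hev
  rw [h0, nonpos_iff_eq_zero, ENNReal.ofReal_eq_zero] at this
  linarith

variable {X Y : Type*} [MeasurableSpace X] [MeasurableSpace Y]

lemma integrable_erealTrunc {Z : Type*} [MeasurableSpace Z] (ρ : Measure Z) [IsFiniteMeasure ρ]
    (n : ℕ) {f : Z → EReal} (hf : Measurable f) : Integrable (fun z => erealTrunc n (f z)) ρ :=
  Integrable.of_bound ((measurable_erealTrunc n).comp hf).aestronglyMeasurable n
    (Eventually.of_forall fun z => by simpa using abs_erealTrunc_le n (f z))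

lemma integral_erealTrunc_sub_congr {π π' : Measure (X × Y)} [IsFiniteMeasure π]
    [IsFiniteMeasure π'] (hfst : π.fst = π'.fst) (hsnd : π.snd = π'.snd) {φ : Y → EReal}
    {ψ : X → EReal} (hφ : Measurable φ) (hψ : Measurable ψ) (n : ℕ) :
    ∫ p, (erealTrunc n (φ p.2) - erealTrunc n (ψ p.1)) ∂π =
      ∫ p, (erealTrunc n (φ p.2) - erealTrunc n (ψ p.1)) ∂π' := by
  have key (ρ : Measure (X × Y)) [IsFiniteMeasure ρ] :
      ∫ p, (erealTrunc n (φ p.2) - erealTrunc n (ψ p.1)) ∂ρ =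
        ∫ y, erealTrunc n (φ y) ∂ρ.snd - ∫ x, erealTrunc n (ψ x) ∂ρ.fst := by
    have h1 : Integrable (fun p : X × Y => erealTrunc n (φ p.2)) ρ :=
      integrable_erealTrunc ρ n (hφ.comp measurable_snd)
    have h2 : Integrable (fun p : X × Y => erealTrunc n (ψ p.1)) ρ :=
      integrable_erealTrunc ρ n (hψ.comp measurable_fst)
    rw [integral_sub h1 h2, Measure.snd, Measure.fst,
      integral_map measurable_snd.aemeasurable
        (integrable_erealTrunc _ n hφ).aestronglyMeasurable,
      integral_map measurable_fst.aemeasurable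
        (integrable_erealTrunc _ n hψ).aestronglyMeasurable]
  rw [key, key, hfst, hsnd]

/-- Deterministic sufficiency: a plan concentrated on the contact set of a pair of (merely
measurable) potentials is optimal, and every optimal plan of finite cost is concentrated there. -/
lemma optimal_of_ae_contact {π π' : Measure (X × Y)} [IsFiniteMeasure π] [IsFiniteMeasure π']
    (hfst : π.fst = π'.fst) (hsnd : π.snd = π'.snd) {φ : Y → EReal} {ψ : X → EReal}
    (hφ : Measurable φ) (hψ : Measurable ψ) (hφt : ∀ y, φ y ≠ ⊤) (hψb : ∀ x, ψ x ≠ ⊥)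
    {c : X → Y → ℝ} (hc : Measurable fun p : X × Y => c p.1 p.2) (hc0 : ∀ x y, 0 ≤ c x y)
    (hle : ∀ x y, φ y - ψ x ≤ (c x y : EReal))
    (hπ : ∀ᵐ p ∂π, φ p.2 - ψ p.1 = (c p.1 p.2 : EReal)) :
    ∫⁻ p, ENNReal.ofReal (c p.1 p.2) ∂π ≤ ∫⁻ p, ENNReal.ofReal (c p.1 p.2) ∂π' ∧
      (∫⁻ p, ENNReal.ofReal (c p.1 p.2) ∂π' ≤ ∫⁻ p, ENNReal.ofReal (c p.1 p.2) ∂π →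
        ∫⁻ p, ENNReal.ofReal (c p.1 p.2) ∂π' ≠ ⊤ →
        ∀ᵐ p ∂π', φ p.2 - ψ p.1 = (c p.1 p.2 : EReal)) := by
  set ξ : ℕ → X × Y → ℝ := fun n p => erealTrunc n (φ p.2) - erealTrunc n (ψ p.1) with hξ
  have hξm (n : ℕ) : Measurable (ξ n) :=
    ((measurable_erealTrunc n).comp (hφ.comp measurable_snd)).sub
      ((measurable_erealTrunc n).comp (hψ.comp measurable_fst))
  have hξi (n : ℕ) (ρ : Measure (X × Y)) [IsFiniteMeasure ρ] : Integrable (ξ n) ρ :=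
    (integrable_erealTrunc ρ n (hφ.comp measurable_snd)).sub
      (integrable_erealTrunc ρ n (hψ.comp measurable_fst))
  have hξc (n : ℕ) (p : X × Y) : ξ n p ≤ c p.1 p.2 :=
    erealTrunc_sub_le n (hψb _) (hc0 _ _) (hle _ _)
  -- On the contact set `φ - ψ = c ≥ 0`, and truncation is monotone.
  have hξ0 (n : ℕ) : ∀ᵐ p ∂π, 0 ≤ ξ n p := by
    filter_upwards [hπ] with p hp
    refine sub_nonneg.2 (erealTrunc_mono n ?_)
    have h0 : (0 : EReal) ≤ φ p.2 - ψ p.1 := by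
      rw [hp]
      exact_mod_cast hc0 p.1 p.2
    simpa using EReal.add_le_of_le_sub h0
  have hξt : ∀ᵐ p ∂π, Tendsto (fun n => ξ n p) atTop (𝓝 (c p.1 p.2)) := by
    filter_upwards [hπ] with p hp
    have := tendsto_erealTrunc_sub (hφt p.2) (hψb p.1)
    rw [hp] at this
    exact EReal.tendsto_coe.1 this
  have hξe (n : ℕ) : ∫ p, ξ n p ∂π = ∫ p, ξ n p ∂π' :=
    integral_erealTrunc_sub_congr hfst hsnd hφ hψ n
  have hint {ρ : Measure (X × Y)} (h : ∫⁻ p, ENNReal.ofReal (c p.1 p.2) ∂ρ ≠ ⊤) :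
      Integrable (fun p : X × Y => c p.1 p.2) ρ :=
    (lintegral_ofReal_ne_top_iff_integrable hc.aestronglyMeasurable
      (Eventually.of_forall fun p => hc0 p.1 p.2)).1 h
  have hofReal {ρ : Measure (X × Y)} (h : Integrable (fun p : X × Y => c p.1 p.2) ρ) :
      ENNReal.ofReal (∫ p, c p.1 p.2 ∂ρ) = ∫⁻ p, ENNReal.ofReal (c p.1 p.2) ∂ρ :=
    ofReal_integral_eq_lintegral_ofReal h (Eventually.of_forall fun p => hc0 p.1 p.2)
  have hopt : ∫⁻ p, ENNReal.ofReal (c p.1 p.2) ∂π ≤ ∫⁻ p, ENNReal.ofReal (c p.1 p.2) ∂π' := by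
    by_cases htop : ∫⁻ p, ENNReal.ofReal (c p.1 p.2) ∂π' = ⊤
    · rw [htop]
      exact le_top
    have hci := hint htop
    calc ∫⁻ p, ENNReal.ofReal (c p.1 p.2) ∂π
        = ∫⁻ p, liminf (fun n => ENNReal.ofReal (ξ n p)) atTop ∂π := by
          refine lintegral_congr_ae ?_
          filter_upwards [hξt] with p hp
          exact ((ENNReal.tendsto_ofReal hp).liminf_eq).symm
      _ ≤ liminf (fun n => ∫⁻ p, ENNReal.ofReal (ξ n p) ∂π) atTop :=
          lintegral_liminf_le fun n => (hξm n).ennreal_ofReal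
      _ ≤ ENNReal.ofReal (∫ p, c p.1 p.2 ∂π') := by
          refine liminf_le_of_le (by isBoundedDefault) fun b hb => ?_
          obtain ⟨n, hn⟩ := hb.exists
          refine hn.trans ?_
          rw [← ofReal_integral_eq_lintegral_ofReal (hξi n π) (hξ0 n), hξe]
          exact ENNReal.ofReal_le_ofReal (integral_mono (hξi n π') hci (hξc n))
      _ = _ := hofReal hci
  refine ⟨hopt, fun hge htop => ?_⟩
  have hci' := hint htop
  have hci := hint (ne_top_of_le_ne_top htop hopt)
  have hlim : Tendsto (fun n => ∫ p, ξ n p ∂π) atTop (𝓝 (∫ p, c p.1 p.2 ∂π)) :=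
    tendsto_integral_of_dominated_convergence (fun p : X × Y => c p.1 p.2)
      (fun n => (hξm n).aestronglyMeasurable) hci
      (fun n => (hξ0 n).mono fun p hp => by
        rw [Real.norm_eq_abs, abs_of_nonneg hp]
        exact hξc n p) hξt
  have heq : ∫ p, c p.1 p.2 ∂π' ≤ ∫ p, c p.1 p.2 ∂π := by
    rw [← hofReal hci, ← hofReal hci'] at hge
    exact (ENNReal.ofReal_le_ofReal_iff
      (integral_nonneg fun p : X × Y => hc0 p.1 p.2)).1 hge
  have hcξ (n : ℕ) : Measurable fun p : X × Y => ENNReal.ofReal (c p.1 p.2 - ξ n p) :=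
    (hc.sub (hξm n)).ennreal_ofReal
  -- Fatou for `c - ξ n ≥ 0` under `π'`: the integral of `ξ n` may be taken under `π`, where it
  -- tends to that of `c`, which is no smaller than the cost of `π'`.
  have hzero : ∫⁻ p, liminf (fun n => ENNReal.ofReal (c p.1 p.2 - ξ n p)) atTop ∂π' = 0 := by
    refine le_zero_iff.1 ((lintegral_liminf_le hcξ).trans ?_)
    have hcongr (n : ℕ) : ∫⁻ p, ENNReal.ofReal (c p.1 p.2 - ξ n p) ∂π' =
        ENNReal.ofReal (∫ p, c p.1 p.2 ∂π' - ∫ p, ξ n p ∂π) := by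
      rw [hξe, ← integral_sub hci' (hξi n π'), ofReal_integral_eq_lintegral_ofReal
        (f := fun p : X × Y => c p.1 p.2 - ξ n p) (hci'.sub (hξi n π'))
        (Eventually.of_forall fun p => sub_nonneg.2 (hξc n p))]
    simp only [hcongr]
    rw [(ENNReal.tendsto_ofReal (tendsto_const_nhds.sub hlim)).liminf_eq, nonpos_iff_eq_zero,
      ENNReal.ofReal_eq_zero]
    linarith
  rw [lintegral_eq_zero_iff (.liminf hcξ)] at hzero
  filter_upwards [hzero] with p hp
  exact sub_eq_coe_of_liminf_erealTrunc (hφt _) (hψb _) (hle _ _) hp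

end Truncation

/-! ### Cyclic exchange of mass between rectangles -/

section CyclicSwap

open scoped ENNReal

/-- The bound on `e` makes each subtracted density at most `1 / (n + 1)`, so the truncated
subtraction is exact even if the sets overlap. -/
lemma MeasureTheory.Measure.withDensity_add_sum_cond {Z : Type*} [MeasurableSpace Z] {n : ℕ}
    (m : Measure Z) [IsFiniteMeasure m] {Q : Fin (n + 1) → Set Z} (hQ : ∀ i, MeasurableSet (Q i))
    {e : ℝ≥0∞} (he0 : e ≠ 0) (he : ∀ i, (n + 1) * e ≤ m (Q i)) :
    m.withDensity (fun p => 1 - ∑ i, (Q i).indicator (fun _ => e * (m (Q i))⁻¹) p)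
      + ∑ i, e • m[|Q i] = m := by
  have hle (i : Fin (n + 1)) : e * (m (Q i))⁻¹ ≤ (n + 1 : ℝ≥0∞)⁻¹ := by
    have hn0 : (n + 1 : ℝ≥0∞) ≠ 0 := by simp
    have hnt : (n + 1 : ℝ≥0∞) ≠ ⊤ := by simp
    have h0 : m (Q i) ≠ 0 := fun h => mul_ne_zero hn0 he0 (le_zero_iff.1 (h ▸ he i))
    rw [← div_eq_mul_inv, ENNReal.div_le_iff h0 (measure_ne_top _ _), ← ENNReal.div_eq_inv_mul,
      ENNReal.le_div_iff_mul_le (.inl hn0) (.inl hnt), mul_comm]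
    exact he i
  have hsum (p : Z) : ∑ i, (Q i).indicator (fun _ => e * (m (Q i))⁻¹) p ≤ 1 := by
    calc ∑ i, (Q i).indicator (fun _ => e * (m (Q i))⁻¹) p
        ≤ ∑ _i : Fin (n + 1), (n + 1 : ℝ≥0∞)⁻¹ := Finset.sum_le_sum fun i _ =>
          (Set.indicator_le_self _ _ p).trans (hle i)
      _ = 1 := by
        rw [Finset.sum_const, Finset.card_univ, Fintype.card_fin, nsmul_eq_mul]
        push_cast
        exact ENNReal.mul_inv_cancel (by simp) (by simp)
  have hmeas (i : Fin (n + 1)) : Measurable ((Q i).indicator fun _ => e * (m (Q i))⁻¹) :=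
    measurable_const.indicator (hQ i)
  ext s hs
  rw [Measure.add_apply, Measure.finsetSum_apply, withDensity_apply _ hs]
  have hterm (i : Fin (n + 1)) : (e • m[|Q i]) s =
      ∫⁻ p in s, (Q i).indicator (fun _ => e * (m (Q i))⁻¹) p ∂m := by
    rw [Measure.smul_apply, cond_apply (hQ i), lintegral_indicator (hQ i), lintegral_const,
      Measure.restrict_restrict (hQ i), Measure.restrict_apply_univ, smul_eq_mul, mul_assoc]
  simp only [hterm]
  rw [← lintegral_finsetSum _ fun i _ => hmeas i,
    ← lintegral_add_right _ (Finset.measurable_fun_sum _ fun i _ => hmeas i)]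
  simp only [tsub_add_cancel_of_le (hsum _), lintegral_one, Measure.restrict_apply_univ]

variable {X Y : Type*} [MeasurableSpace X] [MeasurableSpace Y] {n : ℕ}

/-- The perturbation of a plan `m` that takes mass `e` from each rectangle `U i ×ˢ V i` and puts it
on the rectangles `U i ×ˢ V (i + 1)`, without changing the marginals. -/
noncomputable def cyclicSwap (m : Measure (X × Y)) (U : Fin (n + 1) → Set X)
    (V : Fin (n + 1) → Set Y) (e : ℝ≥0∞) : Measure (X × Y) :=
  m.withDensity (fun p => 1 - ∑ i, (U i ×ˢ V i).indicator (fun _ => e * (m (U i ×ˢ V i))⁻¹) p)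
    + ∑ i, e • (m[|U i ×ˢ V i]).fst.prod (m[|U (i + 1) ×ˢ V (i + 1)]).snd

lemma isProbabilityMeasure_cond_rectangle {m : Measure (X × Y)} [IsFiniteMeasure m]
    {U : Fin (n + 1) → Set X} {V : Fin (n + 1) → Set Y} {e : ℝ≥0∞} (he0 : e ≠ 0)
    (he : ∀ i, (n + 1) * e ≤ m (U i ×ˢ V i)) (i : Fin (n + 1)) :
    IsProbabilityMeasure (m[|U i ×ˢ V i]) :=
  cond_isProbabilityMeasure fun h =>
    mul_ne_zero (by simp : (n + 1 : ℝ≥0∞) ≠ 0) he0 (le_zero_iff.1 (h ▸ he i))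

lemma cyclicSwap_fst {m : Measure (X × Y)} [IsFiniteMeasure m]
    {U : Fin (n + 1) → Set X} {V : Fin (n + 1) → Set Y} (hU : ∀ i, MeasurableSet (U i))
    (hV : ∀ i, MeasurableSet (V i)) {e : ℝ≥0∞} (he0 : e ≠ 0)
    (he : ∀ i, (n + 1) * e ≤ m (U i ×ˢ V i)) :
    (cyclicSwap m U V e).fst = m.fst := by
  have := isProbabilityMeasure_cond_rectangle he0 he
  ext s hs
  conv_rhs => rw [← m.withDensity_add_sum_cond (fun i => (hU i).prod (hV i)) he0 he]
  rw [Measure.fst_apply hs, Measure.fst_apply hs, cyclicSwap, Measure.add_apply, Measure.add_apply,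
    Measure.finsetSum_apply, Measure.finsetSum_apply]
  congr 1
  refine Finset.sum_congr rfl fun i _ => ?_
  rw [Measure.smul_apply, Measure.smul_apply, ← Set.prod_univ, Measure.prod_prod, measure_univ,
    mul_one, Measure.fst_apply hs, Set.prod_univ]

lemma cyclicSwap_snd {m : Measure (X × Y)} [IsFiniteMeasure m]
    {U : Fin (n + 1) → Set X} {V : Fin (n + 1) → Set Y} (hU : ∀ i, MeasurableSet (U i))
    (hV : ∀ i, MeasurableSet (V i)) {e : ℝ≥0∞} (he0 : e ≠ 0)
    (he : ∀ i, (n + 1) * e ≤ m (U i ×ˢ V i)) :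
    (cyclicSwap m U V e).snd = m.snd := by
  have := isProbabilityMeasure_cond_rectangle he0 he
  ext s hs
  conv_rhs => rw [← m.withDensity_add_sum_cond (fun i => (hU i).prod (hV i)) he0 he]
  rw [Measure.snd_apply hs, Measure.snd_apply hs, cyclicSwap, Measure.add_apply, Measure.add_apply,
    Measure.finsetSum_apply, Measure.finsetSum_apply]
  congr 1
  -- The second marginals are those of the original pieces, shifted by one index.
  rw [← Equiv.sum_comp (Equiv.addRight (1 : Fin (n + 1)))
    fun i => (e • m[|U i ×ˢ V i]) (Prod.snd ⁻¹' s)]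
  refine Finset.sum_congr rfl fun i _ => ?_
  rw [Measure.smul_apply, Measure.smul_apply, ← Set.univ_prod, Measure.prod_prod, measure_univ,
    one_mul, Measure.snd_apply hs, Set.univ_prod, Equiv.coe_addRight]

lemma lintegral_cyclicSwap_add_le {m : Measure (X × Y)} [IsFiniteMeasure m]
    {U : Fin (n + 1) → Set X} {V : Fin (n + 1) → Set Y} (hU : ∀ i, MeasurableSet (U i))
    (hV : ∀ i, MeasurableSet (V i)) {e : ℝ≥0∞} (he0 : e ≠ 0)
    (he : ∀ i, (n + 1) * e ≤ m (U i ×ˢ V i))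
    {f : X × Y → ℝ≥0∞} {a b : Fin (n + 1) → ℝ≥0∞}
    (ha : ∀ i, ∀ x ∈ U i, ∀ y ∈ V (i + 1), f (x, y) ≤ a i)
    (hb : ∀ i, ∀ x ∈ U i, ∀ y ∈ V i, b i ≤ f (x, y)) :
    ∫⁻ p, f p ∂(cyclicSwap m U V e) + e * ∑ i, b i ≤ ∫⁻ p, f p ∂m + e * ∑ i, a i := by
  have := isProbabilityMeasure_cond_rectangle he0 he
  have hQ (i : Fin (n + 1)) : ∀ᵐ p ∂m[|U i ×ˢ V i], p ∈ U i ×ˢ V i :=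
    ae_cond_mem ((hU i).prod (hV i))
  have hswap (i : Fin (n + 1)) :
      ∫⁻ p, f p ∂((m[|U i ×ˢ V i]).fst.prod (m[|U (i + 1) ×ˢ V (i + 1)]).snd) ≤ a i := by
    have h1 : ∀ᵐ p ∂((m[|U i ×ˢ V i]).fst.prod (m[|U (i + 1) ×ˢ V (i + 1)]).snd),
        p.1 ∈ U i := by
      refine Measure.quasiMeasurePreserving_fst.ae ?_
      exact (ae_map_iff (p := fun x => x ∈ U i) measurable_fst.aemeasurable (hU i)).2
        ((hQ i).mono fun p hp => hp.1)
    have h2 : ∀ᵐ p ∂((m[|U i ×ˢ V i]).fst.prod (m[|U (i + 1) ×ˢ V (i + 1)]).snd),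
        p.2 ∈ V (i + 1) := by
      refine Measure.quasiMeasurePreserving_snd.ae ?_
      exact (ae_map_iff (p := fun y => y ∈ V (i + 1)) measurable_snd.aemeasurable (hV (i + 1))).2
        ((hQ (i + 1)).mono fun p hp => hp.2)
    calc _ ≤ ∫⁻ _, a i ∂((m[|U i ×ˢ V i]).fst.prod (m[|U (i + 1) ×ˢ V (i + 1)]).snd) :=
          lintegral_mono_ae (by filter_upwards [h1, h2] with p hp1 hp2 using ha i _ hp1 _ hp2)
      _ = a i := by simp
  have hcond (i : Fin (n + 1)) : b i ≤ ∫⁻ p, f p ∂m[|U i ×ˢ V i] := by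
    calc b i = ∫⁻ _, b i ∂m[|U i ×ˢ V i] := by simp
      _ ≤ _ := lintegral_mono_ae (by filter_upwards [hQ i] with p hp using hb i _ hp.1 _ hp.2)
  conv_rhs => rw [← m.withDensity_add_sum_cond (fun i => (hU i).prod (hV i)) he0 he]
  rw [cyclicSwap, lintegral_add_measure, lintegral_add_measure, lintegral_finsetSum_measure,
    lintegral_finsetSum_measure, add_assoc, add_assoc]
  simp only [lintegral_smul_measure, smul_eq_mul, ← Finset.mul_sum, ← mul_add]
  refine add_le_add le_rfl ?_
  gcongr e * ?_
  exact (add_le_add (Finset.sum_le_sum fun i _ => hswap i)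
    (Finset.sum_le_sum fun i _ => hcond i)).trans_eq (add_comm _ _)

end CyclicSwap

/-! ### Measurable swaps of an optimal kernel -/

section OptimalImpliesMonotone

open scoped ENNReal
open TopologicalSpace

variable {Ω X Y : Type*} [MeasurableSpace Ω]

lemma measurable_uncurry_cost [TopologicalSpace X] [PolishSpace X] [MeasurableSpace X]
    [BorelSpace X] [TopologicalSpace Y] [PolishSpace Y] [MeasurableSpace Y] [BorelSpace Y]
    {c : Ω → X → Y → ℝ} (hc_cont : ∀ ω, Continuous (fun p : X × Y => c ω p.1 p.2))
    (hc_meas : ∀ x y, Measurable (fun ω => c ω x y)) :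
    Measurable fun q : Ω × X × Y => c q.1 q.2.1 q.2.2 :=
  (measurable_uncurry_of_continuous_of_measurable (u := fun (p : X × Y) ω => c ω p.1 p.2)
    hc_cont fun p => hc_meas p.1 p.2).comp measurable_swap

/-- By continuity, the condition need only be tested at countably many points dense in `W`. -/
lemma measurableSet_forall_mem_of_isOpen {Z : Type*} [TopologicalSpace Z]
    [SecondCountableTopology Z] {f : Ω → Z → ℝ} (hf : ∀ ω, Continuous (f ω))
    (hfm : ∀ z, Measurable fun ω => f ω z) {W : Set Z} (hW : IsOpen W) {t : Set ℝ}
    (ht : IsClosed t) : MeasurableSet {ω | ∀ z ∈ W, f ω z ∈ t} := by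
  obtain ⟨s, hs, hsd⟩ := exists_countable_dense Z
  have : {ω | ∀ z ∈ W, f ω z ∈ t} = ⋂ z ∈ W ∩ s, {ω | f ω z ∈ t} := by
    ext ω
    simp only [Set.mem_iInter, Set.mem_ofPred_eq]
    refine ⟨fun h z hz => h z hz.1, fun h z hz => ?_⟩
    exact closure_minimal (fun z hz => h z hz) (ht.preimage (hf ω))
      (hsd.open_subset_closure_inter hW hz)
  rw [this]
  exact MeasurableSet.biInter (hs.mono Set.inter_subset_right) fun z _ => hfm z ht.measurableSet

variable [MeasurableSpace X] [MeasurableSpace Y]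

lemma prod_mem_transportKernels (μ : Kernel Ω X) [IsMarkovKernel μ] (ν : Kernel Ω Y)
    [IsMarkovKernel ν] : μ ×ₖ ν ∈ TransportKernels μ ν :=
  ⟨inferInstance, Kernel.fst_prod μ ν, Kernel.snd_prod μ ν⟩

lemma measurable_cyclicSwap {n : ℕ} (π : Kernel Ω (X × Y)) [IsMarkovKernel π]
    {U : Fin (n + 1) → Set X} {V : Fin (n + 1) → Set Y} (hU : ∀ i, MeasurableSet (U i))
    (hV : ∀ i, MeasurableSet (V i)) (e : ℝ≥0∞) :
    Measurable fun ω => cyclicSwap (π ω) U V e := by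
  have hQ (i : Fin (n + 1)) : MeasurableSet (U i ×ˢ V i) := (hU i).prod (hV i)
  let w (i : Fin (n + 1)) : Kernel Ω (X × Y) :=
    ⟨fun ω => (π ω)[|U i ×ˢ V i], Measure.measurable_of_measurable_coe _ fun s hs => by
      simp only [cond_apply (hQ i)]
      exact (π.measurable_coe (hQ i)).inv.mul (π.measurable_coe ((hQ i).inter hs))⟩
  have hw (i : Fin (n + 1)) (ω : Ω) : w i ω = (π ω)[|U i ×ˢ V i] := rfl
  have (i : Fin (n + 1)) : IsFiniteKernel (w i) :=
    ⟨1, ENNReal.one_lt_top, fun ω => prob_le_one (μ := (π ω)[|U i ×ˢ V i])⟩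
  let g : Ω → X × Y → ℝ≥0∞ := fun ω p =>
    1 - ∑ i, (U i ×ˢ V i).indicator (fun _ => e * (π ω (U i ×ˢ V i))⁻¹) p
  have hg : Measurable (Function.uncurry g) := by
    refine measurable_const.sub (Finset.measurable_fun_sum _ fun i _ => ?_)
    exact Measurable.indicator (f := fun q : Ω × X × Y => e * (π q.1 (U i ×ˢ V i))⁻¹)
      (measurable_const.mul ((π.measurable_coe (hQ i)).inv.comp measurable_fst))
      (measurable_snd (hQ i))
  refine Measure.measurable_of_measurable_coe _ fun s hs => ?_
  have heq (ω : Ω) : cyclicSwap (π ω) U V e s = Kernel.withDensity π g ω s +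
      ∑ i, e * ((w i).fst ×ₖ (w (i + 1)).snd) ω s := by
    rw [cyclicSwap, Measure.add_apply, Measure.finsetSum_apply, Kernel.withDensity_apply _ hg]
    simp only [Measure.smul_apply, smul_eq_mul, Kernel.prod_apply, Kernel.fst_apply,
      Kernel.snd_apply, hw]
    rfl
  simp only [heq]
  exact (Kernel.measurable_coe _ hs).add
    (Finset.measurable_fun_sum _ fun i _ => (Kernel.measurable_coe _ hs).const_mul e)

/-- If the plan can be improved on the measurable set `A` by one and the same cyclic rearrangement
of rectangles, then `A` is negligible. -/
lemma IsStochasticOptimal.measure_eq_zero {P : Measure Ω} [IsProbabilityMeasure P]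
    {c : Ω → X → Y → ℝ} {μ : Kernel Ω X} {ν : Kernel Ω Y} {π : Kernel Ω (X × Y)}
    (hopt : IsStochasticOptimal P c μ ν π) (hfin : expectedCost P c π ≠ ⊤) {n : ℕ}
    {U : Fin (n + 1) → Set X} {V : Fin (n + 1) → Set Y} (hU : ∀ i, MeasurableSet (U i))
    (hV : ∀ i, MeasurableSet (V i)) {e : ℝ≥0∞} (he0 : e ≠ 0) (het : e ≠ ⊤)
    {a b : Fin (n + 1) → ℝ≥0∞} (hab : ∑ i, a i < ∑ i, b i)
    {A : Set Ω} (hA : MeasurableSet A)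
    (hAe : ∀ ω ∈ A, ∀ i, (n + 1) * e ≤ π ω (U i ×ˢ V i))
    (hAa : ∀ ω ∈ A, ∀ i, ∀ x ∈ U i, ∀ y ∈ V (i + 1), ENNReal.ofReal (c ω x y) ≤ a i)
    (hAb : ∀ ω ∈ A, ∀ i, ∀ x ∈ U i, ∀ y ∈ V i, b i ≤ ENNReal.ofReal (c ω x y)) : P A = 0 := by
  classical
  obtain ⟨⟨hmk, hfst, hsnd⟩, hmin⟩ := hopt
  let κ : Kernel Ω (X × Y) :=
    Kernel.piecewise hA ⟨fun ω => cyclicSwap (π ω) U V e, measurable_cyclicSwap π hU hV e⟩ π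
  have hκA (ω : Ω) (h : ω ∈ A) : κ ω = cyclicSwap (π ω) U V e := by
    rw [Kernel.piecewise_apply, if_pos h]
    rfl
  have hκAc (ω : Ω) (h : ω ∉ A) : κ ω = π ω := by
    rw [Kernel.piecewise_apply, if_neg h]
  have hκfst (ω : Ω) : (κ ω).fst = (π ω).fst := by
    by_cases h : ω ∈ A
    · rw [hκA ω h, cyclicSwap_fst hU hV he0 (hAe ω h)]
    · rw [hκAc ω h]
  have hκsnd (ω : Ω) : (κ ω).snd = (π ω).snd := by
    by_cases h : ω ∈ A
    · rw [hκA ω h, cyclicSwap_snd hU hV he0 (hAe ω h)]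
    · rw [hκAc ω h]
  have hκ : κ ∈ TransportKernels μ ν := by
    refine ⟨⟨fun ω => ⟨?_⟩⟩, ?_, ?_⟩
    · rw [← Measure.fst_univ, hκfst, Measure.fst_univ, measure_univ]
    · rw [← hfst]
      ext1 ω
      rw [Kernel.fst_apply, Kernel.fst_apply]
      exact hκfst ω
    · rw [← hsnd]
      ext1 ω
      rw [Kernel.snd_apply, Kernel.snd_apply]
      exact hκsnd ω
  have hcost (ω : Ω) : ∫⁻ p, ENNReal.ofReal (c ω p.1 p.2) ∂(κ ω) +
      A.indicator (fun _ => e * ∑ i, b i) ω ≤ ∫⁻ p, ENNReal.ofReal (c ω p.1 p.2) ∂(π ω) +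
      A.indicator (fun _ => e * ∑ i, a i) ω := by
    by_cases h : ω ∈ A
    · rw [hκA ω h, Set.indicator_of_mem h, Set.indicator_of_mem h]
      exact lintegral_cyclicSwap_add_le hU hV he0 (hAe ω h) (hAa ω h) (hAb ω h)
    · rw [hκAc ω h, Set.indicator_of_notMem h, Set.indicator_of_notMem h]
  have hint := lintegral_mono (μ := P) hcost
  rw [lintegral_add_right _ (measurable_const.indicator hA),
    lintegral_add_right _ (measurable_const.indicator hA), lintegral_indicator_const hA,
    lintegral_indicator_const hA] at hint
  have hle : expectedCost P c π ≤ expectedCost P c κ := hmin.le.trans (iInf₂_le κ hκ)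
  have h1 : expectedCost P c π + e * (∑ i, b i) * P A ≤
      expectedCost P c π + e * (∑ i, a i) * P A := (add_le_add_left hle _).trans hint
  -- Finite expected cost is what allows cancellation here.
  rw [ENNReal.add_le_add_iff_left hfin] at h1
  by_contra h0
  have h2 := (ENNReal.mul_le_mul_iff_left h0 (measure_ne_top P A)).1 h1
  exact absurd ((ENNReal.mul_le_mul_iff_right he0 het).1 h2) (not_le.2 hab)

end OptimalImpliesMonotone

/-! ### Reduction to countably many exchange configurations -/

section OptimalImpliesMonotone

open scoped ENNReal Topology
open TopologicalSpace

lemma exists_rectangles_of_not_cyclicallyMonotone {X Y : Type*} [TopologicalSpace X]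
    [SecondCountableTopology X] [TopologicalSpace Y] [SecondCountableTopology Y]
    [MeasurableSpace X] [MeasurableSpace Y] {c : X → Y → ℝ}
    (hc : Continuous fun p : X × Y => c p.1 p.2) (hc0 : ∀ x y, 0 ≤ c x y) {m : Measure (X × Y)}
    (h : ¬ CyclicallyMonotone c m.support) :
    ∃ (n : ℕ) (U : Fin (n + 1) → countableBasis X) (V : Fin (n + 1) → countableBasis Y)
      (a b : Fin (n + 1) → ℚ) (k : ℕ), (∀ i, 0 ≤ a i) ∧ ∑ i, a i < ∑ i, b i ∧
      (∀ i, (n + 1) * ((k + 1 : ℕ) : ℝ≥0∞)⁻¹ ≤ m ((U i : Set X) ×ˢ (V i : Set Y))) ∧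
      (∀ i, ∀ p ∈ (U i : Set X) ×ˢ (V (i + 1) : Set Y), c p.1 p.2 ≤ a i) ∧
      (∀ i, ∀ p ∈ (U i : Set X) ×ˢ (V i : Set Y), (b i : ℝ) ≤ c p.1 p.2) := by
  simp only [CyclicallyMonotone] at h
  push Not at h
  obtain ⟨n, p, hp, hlt⟩ := h
  set η : ℝ := (∑ i, c (p i).1 (p i).2 - ∑ i, c (p i).1 (p (i + 1)).2) / (2 * (n + 1)) with hη
  have hη0 : 0 < η := div_pos (sub_pos.2 hlt) (by positivity)
  -- With gap `2 * (n + 1) * η`, errors below `η` in each of the `n + 1` terms on both sides keep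
  -- the sums strictly ordered.
  choose a ha1 ha2 using fun i => exists_rat_btwn
    (lt_add_of_pos_right (c (p i).1 (p (i + 1)).2) hη0)
  choose b hb1 hb2 using fun i => exists_rat_btwn (sub_lt_self (c (p i).1 (p i).2) hη0)
  have hA (i : Fin (n + 1)) : ∃ S ∈ 𝓝 (p i).1, ∃ T ∈ 𝓝 (p (i + 1)).2,
      S ×ˢ T ⊆ {q : X × Y | c q.1 q.2 < a i} :=
    mem_nhds_prod_iff.1 ((isOpen_lt hc continuous_const).mem_nhds
      (show ((p i).1, (p (i + 1)).2) ∈ {q : X × Y | c q.1 q.2 < a i} from ha1 i))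
  have hB (i : Fin (n + 1)) : ∃ S ∈ 𝓝 (p i).1, ∃ T ∈ 𝓝 (p i).2,
      S ×ˢ T ⊆ {q : X × Y | (b i : ℝ) < c q.1 q.2} :=
    mem_nhds_prod_iff.1 ((isOpen_lt continuous_const hc).mem_nhds
      (show ((p i).1, (p i).2) ∈ {q : X × Y | (b i : ℝ) < c q.1 q.2} from hb2 i))
  choose S₁ hS₁ T₁ hT₁ hST₁ using hA
  choose S₂ hS₂ T₂ hT₂ hST₂ using hB
  have hU (i : Fin (n + 1)) : ∃ U : countableBasis X, (p i).1 ∈ (U : Set X) ∧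
      (U : Set X) ⊆ S₁ i ∩ S₂ i := by
    obtain ⟨U, hU, h1, h2⟩ := (isBasis_countableBasis X).mem_nhds_iff.1
      (Filter.inter_mem (hS₁ i) (hS₂ i))
    exact ⟨⟨U, hU⟩, h1, h2⟩
  -- `V i` is paired with both `U i` and `U (i - 1)`, hence the intersection.
  have hV (i : Fin (n + 1)) : ∃ V : countableBasis Y, (p i).2 ∈ (V : Set Y) ∧
      (V : Set Y) ⊆ T₁ (i - 1) ∩ T₂ i := by
    have h1 := hT₁ (i - 1)
    rw [sub_add_cancel] at h1
    obtain ⟨V, hV, h1, h2⟩ := (isBasis_countableBasis Y).mem_nhds_iff.1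
      (Filter.inter_mem h1 (hT₂ i))
    exact ⟨⟨V, hV⟩, h1, h2⟩
  choose U hpU hUS using hU
  choose V hpV hVT using hV
  have hpos (i : Fin (n + 1)) : 0 < m ((U i : Set X) ×ˢ (V i : Set Y)) :=
    (Measure.mem_support_iff_forall _).1 (hp i) _
      ((((isOpen_of_mem_countableBasis (U i).2).prod
        (isOpen_of_mem_countableBasis (V i).2))).mem_nhds ⟨hpU i, hpV i⟩)
  obtain ⟨i₀, hi₀⟩ := Finite.exists_min fun i => m ((U i : Set X) ×ˢ (V i : Set Y))
  obtain ⟨k, hk⟩ := ENNReal.exists_inv_nat_lt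
    (ENNReal.div_pos (hpos i₀).ne' (by simp : (n + 1 : ℝ≥0∞) ≠ ⊤)).ne'
  refine ⟨n, U, V, a, b, k, fun i => ?_, ?_, fun i => ?_, fun i q hq => ?_, fun i q hq => ?_⟩
  · exact_mod_cast (hc0 _ _).trans (ha1 i).le
  · have h1 : ∑ i, (a i : ℝ) < ∑ i, (c (p i).1 (p (i + 1)).2 + η) :=
      Finset.sum_lt_sum_of_nonempty Finset.univ_nonempty fun i _ => ha2 i
    have h2 : ∑ i, (c (p i).1 (p i).2 - η) < ∑ i, (b i : ℝ) :=
      Finset.sum_lt_sum_of_nonempty Finset.univ_nonempty fun i _ => hb1 i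
    rw [Finset.sum_add_distrib] at h1
    rw [Finset.sum_sub_distrib] at h2
    simp only [Finset.sum_const, Finset.card_univ, Fintype.card_fin, nsmul_eq_mul] at h1 h2
    have h3 : 2 * (((n + 1 : ℕ) : ℝ) * η) =
        ∑ i, c (p i).1 (p i).2 - ∑ i, c (p i).1 (p (i + 1)).2 := by
      rw [hη]
      push_cast
      field_simp
    have h4 : ∑ i, (a i : ℝ) < ∑ i, (b i : ℝ) := by linarith
    exact_mod_cast h4
  · refine le_trans ?_ (hi₀ i)
    rw [mul_comm, ← ENNReal.le_div_iff_mul_le (.inl (by simp)) (.inl (by simp))]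
    refine le_trans (ENNReal.inv_le_inv.2 ?_) hk.le
    exact_mod_cast Nat.le_succ k
  · have h1 := (hVT (i + 1) hq.2).1
    rw [add_sub_cancel_right] at h1
    exact (hST₁ i ⟨(hUS i hq.1).1, h1⟩).le
  · exact (hST₂ i ⟨(hUS i hq.1).2, (hVT i hq.2).2⟩).le

variable {Ω X Y : Type*} [MeasurableSpace Ω]
  [TopologicalSpace X] [PolishSpace X] [MeasurableSpace X] [BorelSpace X]
  [TopologicalSpace Y] [PolishSpace Y] [MeasurableSpace Y] [BorelSpace Y]

theorem IsStochasticOptimal.ae_cyclicallyMonotone {P : Measure Ω} [IsProbabilityMeasure P]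
    {c : Ω → X → Y → ℝ} (hc0 : ∀ ω x y, 0 ≤ c ω x y)
    (hc_cont : ∀ ω, Continuous (fun p : X × Y => c ω p.1 p.2))
    (hc_meas : ∀ x y, Measurable (fun ω => c ω x y))
    {μ : Kernel Ω X} {ν : Kernel Ω Y} {π : Kernel Ω (X × Y)}
    (hopt : IsStochasticOptimal P c μ ν π) (hfin : expectedCost P c π ≠ ⊤) :
    ∀ᵐ ω ∂P, CyclicallyMonotone (c ω) (π ω).support := by
  have hcX : Countable (countableBasis X) := (countable_countableBasis X).to_subtype
  have hcY : Countable (countableBasis Y) := (countable_countableBasis Y).to_subtype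
  have hU (U : countableBasis X) : IsOpen (U : Set X) := isOpen_of_mem_countableBasis U.2
  have hV (V : countableBasis Y) : IsOpen (V : Set Y) := isOpen_of_mem_countableBasis V.2
  have key (n : ℕ) (U : Fin (n + 1) → countableBasis X) (V : Fin (n + 1) → countableBasis Y)
      (a b : Fin (n + 1) → ℚ) (k : ℕ) (ha : ∀ i, 0 ≤ a i) (hab : ∑ i, a i < ∑ i, b i) :
      ∀ᵐ ω ∂P, ¬ ((∀ i, (n + 1) * ((k + 1 : ℕ) : ℝ≥0∞)⁻¹ ≤
          π ω ((U i : Set X) ×ˢ (V i : Set Y))) ∧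
        (∀ i, ∀ p ∈ (U i : Set X) ×ˢ (V (i + 1) : Set Y), c ω p.1 p.2 ∈ Set.Iic (a i : ℝ)) ∧
        (∀ i, ∀ p ∈ (U i : Set X) ×ˢ (V i : Set Y), c ω p.1 p.2 ∈ Set.Ici (b i : ℝ))) := by
    simp only [ae_iff, not_not]
    refine hopt.measure_eq_zero hfin (U := fun i => U i) (V := fun i => V i)
      (fun i => (hU _).measurableSet) (fun i => (hV _).measurableSet)
      (e := ((k + 1 : ℕ) : ℝ≥0∞)⁻¹) (by simp) (by simp)
      (a := fun i => ENNReal.ofReal (a i)) (b := fun i => ENNReal.ofReal (b i)) ?_ ?_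
      (fun ω hω => hω.1)
      (fun ω hω i x hx y hy => ENNReal.ofReal_le_ofReal (hω.2.1 i (x, y) ⟨hx, hy⟩))
      (fun ω hω i x hx y hy => ENNReal.ofReal_le_ofReal (hω.2.2 i (x, y) ⟨hx, hy⟩))
    · have ha' (i : Fin (n + 1)) : (0 : ℝ) ≤ a i := by exact_mod_cast ha i
      have hab' : ∑ i, (a i : ℝ) < ∑ i, (b i : ℝ) := by exact_mod_cast hab
      rw [← ENNReal.ofReal_sum_of_nonneg fun i _ => ha' i]
      -- Some `b i` may be negative; replacing it by its positive part only enlarges the sum.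
      calc ENNReal.ofReal (∑ i, (a i : ℝ)) < ENNReal.ofReal (∑ i, max (b i : ℝ) 0) :=
            (ENNReal.ofReal_lt_ofReal_iff_of_nonneg (Finset.sum_nonneg fun i _ => ha' i)).2
              (hab'.trans_le (Finset.sum_le_sum fun i _ => le_max_left _ _))
        _ = ∑ i, ENNReal.ofReal (b i) := by
            rw [ENNReal.ofReal_sum_of_nonneg fun i _ => le_max_right _ _]
            simp
    · have h1 := MeasurableSet.iInter fun i => measurableSet_le
        (measurable_const (a := (n + 1) * ((k + 1 : ℕ) : ℝ≥0∞)⁻¹))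
        (π.measurable_coe (((hU (U i)).prod (hV (V i))).measurableSet))
      have h2 := MeasurableSet.iInter fun i => measurableSet_forall_mem_of_isOpen
        (f := fun ω (p : X × Y) => c ω p.1 p.2) hc_cont (fun p => hc_meas p.1 p.2)
        ((hU (U i)).prod (hV (V (i + 1)))) (isClosed_Iic (a := (a i : ℝ)))
      have h3 := MeasurableSet.iInter fun i => measurableSet_forall_mem_of_isOpen
        (f := fun ω (p : X × Y) => c ω p.1 p.2) hc_cont (fun p => hc_meas p.1 p.2)
        ((hU (U i)).prod (hV (V i))) (isClosed_Ici (a := (b i : ℝ)))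
      refine (h1.inter (h2.inter h3)).congr ?_
      ext ω
      simp only [Set.mem_inter_iff, Set.mem_iInter, Set.mem_ofPred_eq]
  simp only [← ae_all_iff] at key
  filter_upwards [key] with ω hω
  by_contra hcm
  obtain ⟨n, U, V, a, b, k, ha, hab, h1, h2, h3⟩ :=
    exists_rectangles_of_not_cyclicallyMonotone (hc_cont ω) (hc0 ω) hcm
  exact hω n U V a b k ha hab ⟨h1, h2, h3⟩

end OptimalImpliesMonotone

/-! ### Measurable potentials from monotone supports -/

section MonotoneImpliesPotentials

open TopologicalSpace

lemma measurableSet_mem_support {Ω Z : Type*} [MeasurableSpace Ω] [TopologicalSpace Z]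
    [SecondCountableTopology Z] [MeasurableSpace Z] [OpensMeasurableSpace Z] (κ : Kernel Ω Z) :
    MeasurableSet {q : Ω × Z | q.2 ∈ (κ q.1).support} := by
  have : {q : Ω × Z | q.2 ∈ (κ q.1).support}ᶜ =
      ⋃ U ∈ countableBasis Z, {ω | κ ω U = 0} ×ˢ U := by
    ext q
    simp only [Set.mem_compl_iff, Set.mem_ofPred_eq, Set.mem_iUnion, Set.mem_prod,
      (isBasis_countableBasis Z).nhds_hasBasis.notMem_measureSupport]
    grind
  rw [← MeasurableSet.compl_iff, this]
  refine MeasurableSet.biUnion (countable_countableBasis Z) fun U hU => ?_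
  have hU' := (isOpen_of_mem_countableBasis hU).measurableSet
  exact (κ.measurable_coe hU' (measurableSet_singleton 0)).prod hU'

lemma measurable_chainSum {Ω X Y : Type*} [MeasurableSpace Ω] [MeasurableSpace X]
    [MeasurableSpace Y] {c : Ω → X → Y → ℝ}
    (hc : Measurable fun q : Ω × X × Y => c q.1 q.2.1 q.2.2) {z : ℕ → Ω → X × Y}
    (hz : ∀ n, Measurable (z n)) (l : List ℕ) :
    Measurable fun q : Ω × X => chainSum (c q.1) (fun n => z n q.1) l q.2 := by
  have hself (n : ℕ) : Measurable fun q : Ω × X => c q.1 (z n q.1).1 (z n q.1).2 :=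
    hc.comp (measurable_fst.prodMk ((hz n).comp measurable_fst))
  have hcross (n : ℕ) : Measurable fun q : Ω × X => c q.1 q.2 (z n q.1).2 :=
    hc.comp (measurable_fst.prodMk
      (measurable_snd.prodMk (measurable_snd.comp ((hz n).comp measurable_fst))))
  induction l with
  | nil => exact (hself 0).sub (hcross 0)
  | cons n l ih =>
    exact ((ih.comp (measurable_fst.prodMk
      (measurable_fst.comp ((hz n).comp measurable_fst)))).add (hself n)).sub (hcross n)

variable {Ω X Y : Type*} [MeasurableSpace Ω]
  [TopologicalSpace X] [PolishSpace X] [MeasurableSpace X] [BorelSpace X]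
  [TopologicalSpace Y] [PolishSpace Y] [MeasurableSpace Y] [BorelSpace Y]

/-- For a kernel, almost every conditional law given the second coordinate is carried by the
section of the support. -/
lemma ae_condKernel_swap_compl_support [Nonempty X] (π : Kernel Ω (X × Y)) [IsMarkovKernel π]
    (ω : Ω) : ∀ᵐ p ∂(π ω), (π.map Prod.swap).condKernel (ω, p.2)
      {x | (x, p.2) ∉ (π ω).support} = 0 := by
  have hs : MeasurableSet {q : Y × X | (q.2, q.1) ∉ (π ω).support} :=
    measurable_swap (Measure.isClosed_support (μ := π ω)).measurableSet.compl
  have h := lintegral_condKernel_mem (κ := π.map Prod.swap) ω hs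
  rw [Kernel.map_apply' _ measurable_swap _ hs] at h
  have h0 : π ω (Prod.swap ⁻¹' {q : Y × X | (q.2, q.1) ∉ (π ω).support}) = 0 :=
    Measure.measure_compl_support
  have hm : Measurable fun y => (π.map Prod.swap).condKernel (ω, y)
      (Prod.mk y ⁻¹' {q : Y × X | (q.2, q.1) ∉ (π ω).support}) :=
    Kernel.measurable_kernel_prodMk_left' hs ω
  rw [h0, lintegral_eq_zero_iff hm, Kernel.fst_apply, Kernel.map_apply _ measurable_swap,
    Measure.map_map measurable_fst measurable_swap] at h
  exact ae_of_ae_map (f := Prod.fst ∘ Prod.swap)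
    (measurable_fst.comp measurable_swap).aemeasurable h

theorem exists_isPotentialPair {P : Measure Ω} [IsProbabilityMeasure P]
    {c : Ω → X → Y → ℝ} (hc_cont : ∀ ω, Continuous (fun p : X × Y => c ω p.1 p.2))
    (hc_meas : ∀ x y, Measurable (fun ω => c ω x y))
    (π : Kernel Ω (X × Y)) [IsMarkovKernel π]
    (hmono : ∀ᵐ ω ∂P, CyclicallyMonotone (c ω) (π ω).support) :
    ∃ (φ : Ω × Y → EReal) (ψ : Ω × X → EReal), IsPotentialPair P c π φ ψ := by
  classical
  have hc := measurable_uncurry_cost hc_cont hc_meas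
  obtain ⟨ω₀⟩ : Nonempty Ω := nonempty_of_isProbabilityMeasure P
  obtain ⟨x₀, y₀⟩ : Nonempty (X × Y) := nonempty_of_isProbabilityMeasure (π ω₀)
  have : Nonempty X := ⟨x₀⟩
  obtain ⟨G, hGsub, hG, hGP⟩ : ∃ G : Set Ω, (∀ ω ∈ G, CyclicallyMonotone (c ω) (π ω).support) ∧
      MeasurableSet G ∧ ∀ᵐ ω ∂P, ω ∈ G := by
    obtain ⟨t, ht, htm, ht0⟩ := exists_measurable_superset_of_null (ae_iff.1 hmono)
    exact ⟨tᶜ, fun ω hω => not_not.1 fun h => hω (ht h), htm.compl,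
      measure_eq_zero_iff_ae_notMem.1 ht0⟩
  obtain ⟨z, hzm, hzs, hzd⟩ := exists_measurable_dense_support π fun ω =>
    IsProbabilityMeasure.ne_zero (π ω)
  -- Off `G` the chains may fail to give a proper function; `-c(·, y₀)` is a measurable `c`-convex
  -- substitute.
  let ψ : Ω × X → EReal := fun q => if q.1 ∈ G then
    chainPotential (c q.1) (fun n => z n q.1) q.2 else ((0 - c q.1 q.2 y₀ : ℝ) : EReal)
  have hψG {ω : Ω} (h : ω ∈ G) :
      (fun x => ψ (ω, x)) = chainPotential (c ω) (fun n => z n ω) :=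
    funext fun x => if_pos h
  have hψm : Measurable ψ := by
    refine Measurable.ite (measurable_fst hG)
      (Measurable.iSup fun l => (measurable_chainSum hc hzm l).coe_real_ereal) ?_
    exact (measurable_const.sub (hc.comp (measurable_fst.prodMk
      (measurable_snd.prodMk measurable_const)))).coe_real_ereal
  have hψconv (ω : Ω) : CConvex (c ω) fun x => ψ (ω, x) := by
    by_cases h : ω ∈ G
    · rw [hψG h]
      exact (hGsub ω h).cConvex_chainPotential fun n => hzs n ω
    · have : (fun x => ψ (ω, x)) = fun x => ⨆ _ : Unit, ((0 - c ω x y₀ : ℝ) : EReal) := by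
        funext x
        rw [iSup_const]
        exact if_neg h
      rw [this]
      exact cConvex_iSup (ι := Unit) (c ω) (fun _ => 0) (fun _ => y₀)
        ⟨x₀, by rw [iSup_const]; exact EReal.coe_ne_top _⟩
  have hfin {ω : Ω} (h : ω ∈ G) {x : X} {y : Y} (hxy : (x, y) ∈ (π ω).support) :
      ((ψ (ω, x)).toReal : EReal) = ψ (ω, x) := by
    refine EReal.coe_toReal ?_ ((hψconv ω).1 x)
    have := (hGsub ω h).chainPotential_ne_top (hc_cont ω) (fun n => hzs n ω) (hzd ω hxy)
    rwa [← hψG h] at this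
  have htrans {ω : Ω} (h : ω ∈ G) {x : X} {y : Y} (hxy : (x, y) ∈ (π ω).support) :
      cTransform (c ω) (fun x => ψ (ω, x)) y = (((ψ (ω, x)).toReal + c ω x y : ℝ) : EReal) := by
    rw [EReal.coe_add, hfin h hxy, hψG h]
    exact (cTransform_chainPotential (hc_cont ω) (hzd ω hxy)).trans (by rw [← hψG h])
  let K := (π.map Prod.swap).condKernel
  -- For these `(ω, y)` the conditional law of `x` given `y` lives on the section of the support,
  -- where `ψ + c` is constant and equal to the transform at `y`.
  let H : Set (Ω × Y) := {q | q.1 ∈ G ∧ K q {x | (x, q.2) ∉ (π q.1).support} = 0}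
  have hH : MeasurableSet H := by
    have hT : MeasurableSet {r : (Ω × Y) × X | (r.2, r.1.2) ∉ (π r.1.1).support} := by
      have hmap : Measurable fun r : (Ω × Y) × X => (r.1.1, (r.2, r.1.2)) := by fun_prop
      exact hmap (measurableSet_mem_support π).compl
    exact (measurable_fst hG).inter
      (Kernel.measurable_kernel_prodMk_left (κ := K) hT (measurableSet_singleton 0))
  -- A kernel integral is measurable in its parameter. The value `⊥` makes the inequality trivial
  -- and excludes contact.
  let φ : Ω × Y → EReal := fun q => if q ∈ H then
    ((∫ x, ((ψ (q.1, x)).toReal + c q.1 x q.2) ∂(K q) : ℝ) : EReal) else ⊥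
  have hφm : Measurable φ := by
    refine Measurable.ite hH ?_ measurable_const
    have hψm' : Measurable fun r : (Ω × Y) × X => (ψ (r.1.1, r.2)).toReal :=
      (hψm.comp (by fun_prop)).ereal_toReal
    have hc' : Measurable fun r : (Ω × Y) × X => c r.1.1 r.2 r.1.2 :=
      hc.comp (g := fun q : Ω × X × Y => c q.1 q.2.1 q.2.2)
        (f := fun r : (Ω × Y) × X => (r.1.1, r.2, r.1.2)) (by fun_prop)
    exact (StronglyMeasurable.integral_kernel_prod_right'
      (hψm'.add hc').stronglyMeasurable).measurable.coe_real_ereal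
  have hφH {ω : Ω} {y : Y} (h : (ω, y) ∈ H) :
      φ (ω, y) = cTransform (c ω) (fun x => ψ (ω, x)) y := by
    have hae : ∀ᵐ x ∂(K (ω, y)), (x, y) ∈ (π ω).support := h.2
    obtain ⟨x₁, hx₁⟩ := hae.exists
    have hconst : ∀ᵐ x ∂(K (ω, y)),
        (ψ (ω, x)).toReal + c ω x y = (ψ (ω, x₁)).toReal + c ω x₁ y := by
      filter_upwards [hae] with x hx
      exact EReal.coe_injective ((htrans h.1 hx).symm.trans (htrans h.1 hx₁))
    rw [htrans h.1 hx₁]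
    refine (if_pos h).trans ?_
    rw [integral_congr_ae hconst]
    simp
  have hφbot {q : Ω × Y} (h : q ∉ H) : φ q = ⊥ := if_neg h
  refine ⟨φ, ψ, hφm, hψm, fun ω x y => EReal.sub_le_of_le_add ?_, hψconv, fun ω p hp => ?_, ?_⟩
  · by_cases h : (ω, y) ∈ H
    · rw [hφH h, add_comm]
      exact iInf_le (fun x => ψ (ω, x) + (c ω x y : EReal)) x
    · rw [hφbot h]
      exact bot_le
  · have hp' : φ (ω, p.2) - ψ (ω, p.1) = (c ω p.1 p.2 : EReal) := hp
    by_cases h : (ω, p.2) ∈ H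
    · rwa [hφH h] at hp'
    · rw [hφbot h, EReal.bot_sub] at hp'
      exact absurd hp'.symm (EReal.coe_ne_bot _)
  · filter_upwards [hGP] with ω hω
    filter_upwards [Measure.support_mem_ae (μ := π ω), ae_condKernel_swap_compl_support π ω]
      with p hp hp0
    change φ (ω, p.2) - ψ (ω, p.1) = (c ω p.1 p.2 : EReal)
    rw [hφH ⟨hω, hp0⟩, htrans hω (x := p.1) hp, ← hfin hω (y := p.2) hp, ← EReal.coe_sub,
      EReal.toReal_coe, add_sub_cancel_left]

end MonotoneImpliesPotentials

/-! ### From pointwise duality to the expected cost -/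

section PotentialsImplyOptimal

variable {Ω X Y : Type*} [MeasurableSpace Ω] [MeasurableSpace X] [MeasurableSpace Y]
  {P : Measure Ω} {c : Ω → X → Y → ℝ} {μ : Kernel Ω X} {ν : Kernel Ω Y} {π π' : Kernel Ω (X × Y)}
  {φ : Ω × Y → EReal} {ψ : Ω × X → EReal}

lemma IsPotentialPair.ne_top (h : IsPotentialPair P c π φ ψ) (ω : Ω) (y : Y) : φ (ω, y) ≠ ⊤ := by
  intro htop
  obtain ⟨x, hx⟩ := (h.cConvex ω).2.1
  have := h.sub_le ω x y
  rw [htop, EReal.top_sub hx] at this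
  exact EReal.coe_ne_top _ (top_le_iff.1 this)

lemma IsPotentialPair.measurableSet_contactSet (h : IsPotentialPair P c π φ ψ)
    (hc : Measurable fun q : Ω × X × Y => c q.1 q.2.1 q.2.2) :
    MeasurableSet {q : Ω × X × Y | q.2 ∈ contactSet c φ ψ q.1} := by
  have h1 : Measurable fun q : Ω × X × Y => φ (q.1, q.2.2) :=
    h.measurable_left.comp (by fun_prop)
  have h2 : Measurable fun q : Ω × X × Y => -ψ (q.1, q.2.1) :=
    continuous_neg.measurable.comp (h.measurable_right.comp (by fun_prop))
  exact measurableSet_eq_fun (h1.add h2) hc.coe_real_ereal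

lemma IsPotentialPair.ae_optimal (h : IsPotentialPair P c π φ ψ)
    (hc : Measurable fun q : Ω × X × Y => c q.1 q.2.1 q.2.2) (hc0 : ∀ ω x y, 0 ≤ c ω x y)
    (hπ : π ∈ TransportKernels μ ν) (hπ' : π' ∈ TransportKernels μ ν) :
    ∀ᵐ ω ∂P, ∫⁻ p, ENNReal.ofReal (c ω p.1 p.2) ∂(π ω) ≤
        ∫⁻ p, ENNReal.ofReal (c ω p.1 p.2) ∂(π' ω) ∧
      (∫⁻ p, ENNReal.ofReal (c ω p.1 p.2) ∂(π' ω) ≤ ∫⁻ p, ENNReal.ofReal (c ω p.1 p.2) ∂(π ω) →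
        ∫⁻ p, ENNReal.ofReal (c ω p.1 p.2) ∂(π' ω) ≠ ⊤ →
        ∀ᵐ p ∂(π' ω), p ∈ contactSet c φ ψ ω) := by
  obtain ⟨hm, hfst, hsnd⟩ := hπ
  obtain ⟨hm', hfst', hsnd'⟩ := hπ'
  filter_upwards [h.full_measure] with ω hω
  refine optimal_of_ae_contact (φ := fun y => φ (ω, y)) (ψ := fun x => ψ (ω, x)) ?_ ?_
    (h.measurable_left.comp measurable_prodMk_left)
    (h.measurable_right.comp measurable_prodMk_left) (h.ne_top ω) (h.cConvex ω).1
    (hc.comp measurable_prodMk_left) (hc0 ω) (h.sub_le ω) hω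
  · exact (Kernel.fst_apply π ω).symm.trans
      ((DFunLike.congr_fun (hfst.trans hfst'.symm) ω).trans (Kernel.fst_apply π' ω))
  · exact (Kernel.snd_apply π ω).symm.trans
      ((DFunLike.congr_fun (hsnd.trans hsnd'.symm) ω).trans (Kernel.snd_apply π' ω))

theorem IsPotentialPair.isStochasticOptimal (h : IsPotentialPair P c π φ ψ)
    (hc : Measurable fun q : Ω × X × Y => c q.1 q.2.1 q.2.2) (hc0 : ∀ ω x y, 0 ≤ c ω x y)
    (hπ : π ∈ TransportKernels μ ν) : IsStochasticOptimal P c μ ν π :=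
  ⟨hπ, le_antisymm (le_iInf₂ fun _ hπ' =>
    lintegral_mono_ae ((h.ae_optimal hc hc0 hπ hπ').mono fun _ hω => hω.1)) (iInf₂_le π hπ)⟩

theorem IsPotentialPair.ae_mem_contactSet (h : IsPotentialPair P c π φ ψ)
    (hc : Measurable fun q : Ω × X × Y => c q.1 q.2.1 q.2.2) (hc0 : ∀ ω x y, 0 ≤ c ω x y)
    (hπ : π ∈ TransportKernels μ ν) (hopt : IsStochasticOptimal P c μ ν π')
    (hfin : stochasticCost P c μ ν ≠ ⊤) :
    ∀ᵐ ω ∂P, ∀ᵐ p ∂(π' ω), p ∈ contactSet c φ ψ ω := by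
  have hm : IsMarkovKernel π := hπ.1
  have hm' : IsMarkovKernel π' := hopt.1.1
  have hmeas (κ : Kernel Ω (X × Y)) [IsMarkovKernel κ] :
      Measurable fun ω => ∫⁻ p, ENNReal.ofReal (c ω p.1 p.2) ∂(κ ω) :=
    Measurable.lintegral_kernel_prod_right' (κ := κ)
      (f := fun q : Ω × X × Y => ENNReal.ofReal (c q.1 q.2.1 q.2.2)) hc.ennreal_ofReal
  have hcost : expectedCost P c π' = expectedCost P c π :=
    hopt.2.trans (h.isStochasticOptimal hc hc0 hπ).2.symm
  have hae := h.ae_optimal hc hc0 hπ hopt.1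
  have hfin' : expectedCost P c π' ≠ ⊤ := hopt.2 ▸ hfin
  -- The fibre costs are ordered and their expectations are equal and finite, so they agree almost
  -- everywhere.
  have heq := ae_eq_of_ae_le_of_lintegral_le (hae.mono fun _ hω => hω.1) (hcost.symm.trans_ne hfin')
    (hmeas π').aemeasurable hcost.le
  filter_upwards [hae, heq, ae_lt_top (hmeas π') hfin'] with ω h1 h2 h3
  exact h1.2 h2.ge h3.ne

end PotentialsImplyOptimal

theorem theorem1p3 {Ω X Y : Type*} [MeasurableSpace Ω]
    [TopologicalSpace X] [PolishSpace X] [MeasurableSpace X] [BorelSpace X]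
    [TopologicalSpace Y] [PolishSpace Y] [MeasurableSpace Y] [BorelSpace Y]
    (P : Measure Ω) [IsProbabilityMeasure P]
    (μ : Kernel Ω X) [IsMarkovKernel μ] (ν : Kernel Ω Y) [IsMarkovKernel ν]
    (c : Ω → X → Y → ℝ) (hc_nonneg : ∀ ω x y, 0 ≤ c ω x y)
    (hc_cont : ∀ ω, Continuous (fun p : X × Y => c ω p.1 p.2))
    (hc_meas : ∀ x y, Measurable (fun ω => c ω x y))
    (hc_fin : ∫⁻ ω, ∫⁻ p, ENNReal.ofReal (c ω p.1 p.2) ∂((μ ω).prod (ν ω)) ∂P < ⊤)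
    (π : Kernel Ω (X × Y)) (hπ : π ∈ TransportKernels μ ν) :
    List.TFAE
      [ IsStochasticOptimal P c μ ν π,
        ∀ᵐ ω ∂P, CyclicallyMonotone (c ω) (π ω).support,
        ∃ (φ : Ω × Y → EReal) (ψ : Ω × X → EReal), IsPotentialPair P c π φ ψ ] ∧
    ∀ (φ : Ω × Y → EReal) (ψ : Ω × X → EReal), IsPotentialPair P c π φ ψ →
      MeasurableSet {q : Ω × X × Y | q.2 ∈ contactSet c φ ψ q.1} ∧
      ∀ π' : Kernel Ω (X × Y), IsStochasticOptimal P c μ ν π' →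
        ∀ᵐ ω ∂P, ∀ᵐ p ∂(π' ω), p ∈ contactSet c φ ψ ω := by
  have hc := measurable_uncurry_cost hc_cont hc_meas
  have hm : IsMarkovKernel π := hπ.1
  have hfin : stochasticCost P c μ ν ≠ ⊤ := by
    refine ne_top_of_le_ne_top hc_fin.ne ((iInf₂_le _ (prod_mem_transportKernels μ ν)).trans_eq ?_)
    simp only [expectedCost, Kernel.prod_apply]
  constructor
  · tfae_have 1 → 2 := fun h =>
      h.ae_cyclicallyMonotone hc_nonneg hc_cont hc_meas (h.2 ▸ hfin)
    tfae_have 2 → 3 := exists_isPotentialPair hc_cont hc_meas π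
    tfae_have 3 → 1 := fun ⟨_, _, h⟩ => h.isStochasticOptimal hc hc_nonneg hπ
    tfae_finish
  · exact fun φ ψ h => ⟨h.measurableSet_contactSet hc, fun π' hπ' =>
      h.ae_mem_contactSet hc hc_nonneg hπ hπ' hfin⟩
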